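/- All graphs are finite and simple. A tree model of a graph $G=(V_G,E_G)$ is a pair $(T,\{T_v\}_{v\in V_G})$, where $T$ is a tree (the host tree), each $T_v$ is a (nonempty) subtree of $T$, and distinct vertices $u,v$ are adjacent in $G$ if and only if $V(T_u)\cap V(T_v)\neq\emptyset$. A graph is chordal if it has a tree model, and its leafage $\ell(G)$ is the least number of leaves (nodes of degree one) of the host tree in a tree model of $G$. A leaf of a rooted tree is a node other than the root that has no children; if $T$ is rooted, each $T_v$ is rooted at its node closest to the root of $T$. A tree model is expanded if $T$ is rooted, every $T_v$ has at least one leaf as a rooted tree, and every node of $T$ is the root or a leaf of $T_v$ for at most one vertex $v$. In the Subset Feedback Vertex Set problem one is given a graph $G$ with integer vertex weights and a set $S\subseteq V_G$, and asks for a set $X\subseteq V_G$ of minimum total weight that meets every cycle of $G$ that contains a vertex of $S$. Theorem. There is an algorithm that, given a connected chordal graph $G$ on $n$ vertices with leafage $\ell=\ell(G)\ge 2$, a set $S\subseteq V_G$, integer vertex weights, and an expanded tree model of $G$ whose rooted host tree has at most $\ell$ leaves and $O(n)$ nodes, outputs a minimum-weight solution of Subset Feedback Vertex Set in $O(n^{2\ell+1})$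 time. Precisely: there is one program for the uniform-cost random access machine (integer registers and arrays, with addition, subtraction, comparison with zero and indirect addressing) such that for all integers $\ell\ge 2$ and $K\ge 0$ there is a constant $C$ for which, on every such input with leafage $\ell$ and at most $Kn$ host nodes, the program halts after at most $Cn^{2\ell+1}$ steps with an optimal solution as its output. (The graph is given by its adjacency matrix, the host tree by its parent pointers, and the subtrees by their membership matrix.) -/

import Mathlib

/-! ### Rooted host trees and tree models -/

/-- A rooted tree on the nodes `0, …, N - 1`, whose edges are directed towards the root: every node
other than the root points to its parent, and following the parents one arrives at the root. (By
convention the root is its own parent.) -/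
structure HostTree (N : ℕ) where
  root : Fin N
  parent : Fin N → Fin N
  parent_root : parent root = root
  reaches_root : ∀ x, ∃ k : ℕ, parent^[k] x = root

namespace HostTree

variable {N : ℕ} (T : HostTree N)

/-- The underlying undirected tree: its edges join the nodes `x` other than the root with
`parent x`. -/
def graph : SimpleGraph (Fin N) := SimpleGraph.fromRel fun x y => T.parent x = y

/-- `x` is a descendant of `y`, that is, there is a directed path (possibly of length `0`) from `x`
to `y`. -/
def Desc (x y : Fin N) : Prop := ∃ k : ℕ, T.parent^[k] x = y

/-- `s` is the node set of a subtree of the tree, that is, it is nonempty and connected. -/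
def IsSubtree (s : Set (Fin N)) : Prop := (T.graph.induce s).Connected

/-- `t` is the root of the subtree `s`. -/
def IsRootOf (s : Set (Fin N)) (t : Fin N) : Prop := t ∈ s ∧ ∀ x ∈ s, T.Desc x t

/-- `x` is a leaf of the rooted subtree `s`: a node of `s`, not the root of `s`, that has no child
in `s`. In particular a one-node subtree has no leaf. -/
def IsLeafOf (s : Set (Fin N)) (x : Fin N) : Prop :=
  x ∈ s ∧ ¬ T.IsRootOf s x ∧ ∀ y ∈ s, T.parent y ≠ x

/-- The number of leaves of the rooted tree. The root is never a leaf. -/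
noncomputable def numRootedLeaves : ℕ := {x | T.IsLeafOf Set.univ x}.ncard

/-- The number of leaves of the underlying undirected tree: the nodes of degree one. (A one-node
tree has no leaf.) -/
noncomputable def numLeaves : ℕ := {x | (T.graph.neighborSet x).ncard = 1}.ncard

end HostTree

/-- A tree model of a graph `G`, with a host tree on `N` nodes: every vertex `v` of `G` is assigned
a subtree of the host tree, and two distinct vertices are adjacent if and only if their subtrees
share a node. The graphs that have a tree model are the chordal graphs. -/
structure TreeModel {n : ℕ} (G : SimpleGraph (Fin n)) (N : ℕ) where
  host : HostTree N
  sub : Fin n → Set (Fin N)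
  isSubtree : ∀ v, host.IsSubtree (sub v)
  adj_iff : ∀ u v, u ≠ v → (G.Adj u v ↔ (sub u ∩ sub v).Nonempty)

/-- A tree model is expanded if every subtree `T_v` has a leaf (as a rooted tree), and every node of
the host tree is the root or a leaf of at most one of the subtrees `T_v`. -/
def TreeModel.IsExpanded {n : ℕ} {G : SimpleGraph (Fin n)} {N : ℕ} (M : TreeModel G N) : Prop :=
  (∀ v, ∃ x, M.host.IsLeafOf (M.sub v) x) ∧
  ∀ x u v,
    (M.host.IsRootOf (M.sub u) x ∨ M.host.IsLeafOf (M.sub u) x) →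
    (M.host.IsRootOf (M.sub v) x ∨ M.host.IsLeafOf (M.sub v) x) → u = v

/-- The leafage of a chordal graph: the least number of leaves of the (undirected) host tree in a
tree model of the graph. -/
noncomputable def leafage {n : ℕ} (G : SimpleGraph (Fin n)) : ℕ :=
  sInf {k | ∃ (N : ℕ) (M : TreeModel G N), M.host.numLeaves = k}

/-! ### Subset Feedback Vertex Set -/

/-- `X` is a subset feedback vertex set of `(G, S)`: it meets every cycle of `G` that contains a
vertex of `S`. -/
def IsSubsetFVS {n : ℕ} (G : SimpleGraph (Fin n)) (S X : Finset (Fin n)) : Prop :=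
  ∀ (v : Fin n) (c : G.Walk v v), c.IsCycle → (∃ s ∈ S, s ∈ c.support) → ∃ x ∈ X, x ∈ c.support

/-- `X` is a subset feedback vertex set of `(G, S)` of minimum weight. -/
def IsMinSubsetFVS {n : ℕ} (G : SimpleGraph (Fin n)) (S : Finset (Fin n)) (w : Fin n → ℤ)
    (X : Finset (Fin n)) : Prop :=
  IsSubsetFVS G S X ∧ ∀ Y, IsSubsetFVS G S Y → ∑ v ∈ X, w v ≤ ∑ v ∈ Y, w v

/-! ### Random access machines

The uniform-cost random access machine over the integers, with addition and subtraction as its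
arithmetic, programmed in a structured language. A program is a finite object, so that it mentions
only finitely many registers and arrays, and all of them by constant names; only the positions
within an array are addressed indirectly. -/

/-- A state of the machine: the contents of the registers, and of the cells of the arrays. -/
structure RAMState where
  reg : ℕ → ℤ
  arr : ℕ → ℕ → ℤ

/-- Programs. -/
inductive RAMProg where
  /-- do nothing -/
  | skip : RAMProg
  /-- `reg d := c` -/
  | const (d : ℕ) (c : ℤ) : RAMProg
  /-- `reg d := reg a + reg b` -/
  | add (d a b : ℕ) : RAMProg
  /-- `reg d := reg a - reg b` -/
  | sub (d a b : ℕ) : RAMProg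
  /-- `reg d := arr a [reg i]` -/
  | load (d a i : ℕ) : RAMProg
  /-- `arr a [reg i] := reg s` -/
  | store (a i s : ℕ) : RAMProg
  /-- first `p`, then `q` -/
  | seq (p q : RAMProg) : RAMProg
  /-- if `reg a > 0` then `p` else `q` -/
  | cond (a : ℕ) (p q : RAMProg) : RAMProg
  /-- while `reg a > 0` do `p` -/
  | loop (a : ℕ) (p : RAMProg) : RAMProg

namespace RAMState

/-- Write the value `z` into register `d`. -/
def setReg (σ : RAMState) (d : ℕ) (z : ℤ) : RAMState :=
  { σ with reg := Function.update σ.reg d z }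

/-- Write the value `z` into cell `i` of array `a`. -/
def setArr (σ : RAMState) (a i : ℕ) (z : ℤ) : RAMState :=
  { σ with arr := Function.update σ.arr a (Function.update (σ.arr a) i z) }

end RAMState

/-- `Exec p σ τ t`: started in the state `σ`, the program `p` halts in the state `τ` after exactly
`t` steps. Each elementary instruction and each evaluation of a test takes one step. A negative
position in an array is read as position `0`. -/
inductive Exec : RAMProg → RAMState → RAMState → ℕ → Prop
  | skip (σ : RAMState) : Exec RAMProg.skip σ σ 1
  | const (σ : RAMState) (d : ℕ) (c : ℤ) : Exec (RAMProg.const d c) σ (σ.setReg d c) 1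
  | add (σ : RAMState) (d a b : ℕ) :
      Exec (RAMProg.add d a b) σ (σ.setReg d (σ.reg a + σ.reg b)) 1
  | sub (σ : RAMState) (d a b : ℕ) :
      Exec (RAMProg.sub d a b) σ (σ.setReg d (σ.reg a - σ.reg b)) 1
  | load (σ : RAMState) (d a i : ℕ) :
      Exec (RAMProg.load d a i) σ (σ.setReg d (σ.arr a (σ.reg i).toNat)) 1
  | store (σ : RAMState) (a i s : ℕ) :
      Exec (RAMProg.store a i s) σ (σ.setArr a (σ.reg i).toNat (σ.reg s)) 1
  | seq (p q : RAMProg) (σ ρ τ : RAMState) (t₁ t₂ : ℕ) :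
      Exec p σ ρ t₁ → Exec q ρ τ t₂ → Exec (RAMProg.seq p q) σ τ (t₁ + t₂)
  | cond_pos (a : ℕ) (p q : RAMProg) (σ τ : RAMState) (t : ℕ) :
      0 < σ.reg a → Exec p σ τ t → Exec (RAMProg.cond a p q) σ τ (t + 1)
  | cond_neg (a : ℕ) (p q : RAMProg) (σ τ : RAMState) (t : ℕ) :
      ¬ 0 < σ.reg a → Exec q σ τ t → Exec (RAMProg.cond a p q) σ τ (t + 1)
  | loop_done (a : ℕ) (p : RAMProg) (σ : RAMState) :
      ¬ 0 < σ.reg a → Exec (RAMProg.loop a p) σ σ 1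
  | loop_step (a : ℕ) (p : RAMProg) (σ ρ τ : RAMState) (t₁ t₂ : ℕ) :
      0 < σ.reg a → Exec p σ ρ t₁ → Exec (RAMProg.loop a p) ρ τ t₂ →
      Exec (RAMProg.loop a p) σ τ (t₁ + t₂ + 1)

/-! ### Input and output conventions -/

open Classical in
/-- The contents of the arrays at the start, for the graph `G` with terminal set `S`, vertex weights
`w` and tree model `M`; cells that are not mentioned hold `0`.
* Array `0` holds `n`, the number `N` of host nodes, and the root of the host tree.
* Array `1` is the adjacency matrix of `G`: cell `n * u + v` holds `1` if `u` and `v` are adjacent.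
* Array `2` is the indicator of `S`: cell `v` holds `1` if `v ∈ S`.
* Array `3` holds the weights: cell `v` holds `w v`.
* Array `4` is the host tree: cell `x` holds the parent of `x` (the root is its own parent).
* Array `5` holds the subtrees: cell `N * v + x` holds `1` if `x` is a node of the subtree of `v`. -/
noncomputable def inputArr {n N : ℕ} (G : SimpleGraph (Fin n)) (S : Finset (Fin n))
    (w : Fin n → ℤ) (M : TreeModel G N) : ℕ → ℕ → ℤ
  | 0, 0 => n
  | 0, 1 => N
  | 0, 2 => (M.host.root : ℕ)
  | 1, i => if ∃ u v : Fin n, G.Adj u v ∧ i = n * u + v then 1 else 0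
  | 2, i => if ∃ v ∈ S, i = (v : ℕ) then 1 else 0
  | 3, i => if h : i < n then w ⟨i, h⟩ else 0
  | 4, i => if h : i < N then ((M.host.parent ⟨i, h⟩ : ℕ) : ℤ) else 0
  | 5, i => if ∃ (v : Fin n) (x : Fin N), x ∈ M.sub v ∧ i = N * v + x then 1 else 0
  | _, _ => 0

/-- The initial state: the input is in the arrays and all registers are `0`. -/
noncomputable def inputState {n N : ℕ} (G : SimpleGraph (Fin n)) (S : Finset (Fin n))
    (w : Fin n → ℤ) (M : TreeModel G N) : RAMState :=
  { reg := fun _ => 0, arr := inputArr G S w M }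

/-- The final state `τ` outputs the vertex set `X`: the first `n` cells of array `6` are the
indicator of `X`. -/
def Outputs {n : ℕ} (τ : RAMState) (X : Finset (Fin n)) : Prop :=
  ∀ v : Fin n, τ.arr 6 v = if v ∈ X then 1 else 0

/-! A cycle through a terminal of a chordal graph yields a triangle through a terminal: eliminate
the vertices by decreasing level, where the level of a vertex is the depth of the root of its
subtree. The complements of the solutions are thus the vertex sets without terminal triangles.

A set of this kind of maximal weight is built up by increasing level. The earlier neighbours of a
vertex `v` are the earlier vertices whose subtrees contain the root of the subtree of `v`. To decide
whether `v` may be added, it suffices to know, for a tip of the host tree below that root, the two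
chosen vertices whose subtrees come closest to the tip: if these are neighbours of `v` and a third
chosen neighbour is a terminal, then the three of them form a terminal triangle already. Of these
two vertices only the level that is reached matters and whether they are terminals, which together
is a label less than `2N + 2`. This gives at most `(2N + 2) ^ (2ℓ)` states, and the transitions
for `v` are read off from a table with one entry for each tip and each pair of labels. -/

/-! ### A program logic for the random access machine -/

namespace RAMProg

/-- The registers that a program may write. -/
def regs : RAMProg → List ℕ
  | skip => []
  | const d _ => [d]
  | add d _ _ => [d]
  | sub d _ _ => [d]
  | load d _ _ => [d]
  | store _ _ _ => []
  | seq p q => p.regs ++ q.regs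
  | cond _ p q => p.regs ++ q.regs
  | loop _ p => p.regs

/-- The arrays that a program may write. -/
def arrs : RAMProg → List ℕ
  | skip => []
  | const _ _ => []
  | add _ _ _ => []
  | sub _ _ _ => []
  | load _ _ _ => []
  | store a _ _ => [a]
  | seq p q => p.arrs ++ q.arrs
  | cond _ p q => p.arrs ++ q.arrs
  | loop _ p => p.arrs

/-- Sequential composition of a list of programs. -/
def block : List RAMProg → RAMProg
  | [] => skip
  | [p] => p
  | p :: q :: l => seq p (block (q :: l))

/-- The register that holds the constant `1` while a program runs. -/
@[simp] abbrev oneReg : ℕ := 0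

/-- The downward for-loop: decrement register `c` and run `body`, until `c` is `0`. If `c` holds `k`
at the start, then the body sees the values `k - 1, …, 0` in `c`. -/
def forDown (c : ℕ) (body : RAMProg) : RAMProg := loop c (seq (sub c c oneReg) body)

/-- Multiplication by repeated addition, since the machine cannot multiply: add register `a` to
register `d` as often as register `c` says. The loop leaves `0` in `c`. -/
def addMul (d a c : ℕ) : RAMProg := forDown c (add d d a)

end RAMProg

namespace RAMState

@[simp] theorem setReg_reg (σ : RAMState) (d : ℕ) (z : ℤ) (a : ℕ) :
    (σ.setReg d z).reg a = if a = d then z else σ.reg a :=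
  Function.update_apply _ _ _ _

@[simp] theorem setReg_arr (σ : RAMState) (d : ℕ) (z : ℤ) : (σ.setReg d z).arr = σ.arr := rfl

@[simp] theorem setArr_reg (σ : RAMState) (a i : ℕ) (z : ℤ) : (σ.setArr a i z).reg = σ.reg := rfl

@[simp] theorem setArr_arr (σ : RAMState) (a i : ℕ) (z : ℤ) (b j : ℕ) :
    (σ.setArr a i z).arr b j = if b = a ∧ j = i then z else σ.arr b j := by
  by_cases h : b = a
  · subst h
    simp [setArr, Function.update_apply]
  · simp [setArr, h]

end RAMState

/-- The frame condition of a program: `τ` agrees with `σ` on all registers and arrays that `p` does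
not write. -/
structure Frame (p : RAMProg) (σ τ : RAMState) : Prop where
  reg : ∀ r, r ∉ p.regs → τ.reg r = σ.reg r
  arr : ∀ a, a ∉ p.arrs → τ.arr a = σ.arr a

namespace Frame

variable {p q : RAMProg} {σ ρ τ : RAMState}

theorem refl (p : RAMProg) (σ : RAMState) : Frame p σ σ := ⟨fun _ _ => rfl, fun _ _ => rfl⟩

theorem trans (h₁ : Frame p σ ρ) (h₂ : Frame p ρ τ) : Frame p σ τ :=
  ⟨fun r hr => (h₂.reg r hr).trans (h₁.reg r hr), fun a ha => (h₂.arr a ha).trans (h₁.arr a ha)⟩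

theorem mono (h : Frame p σ τ) (hr : p.regs ⊆ q.regs) (ha : p.arrs ⊆ q.arrs) : Frame q σ τ :=
  ⟨fun r hrq => h.reg r (mt (@hr r) hrq), fun a haq => h.arr a (mt (@ha a) haq)⟩

theorem setReg {d : ℕ} (hd : d ∈ p.regs) (z : ℤ) : Frame p σ (σ.setReg d z) :=
  ⟨fun r hr => by rw [RAMState.setReg_reg, if_neg (fun h : r = d => hr (h ▸ hd))], fun _ _ => rfl⟩

theorem setArr {a : ℕ} (ha : a ∈ p.arrs) (i : ℕ) (z : ℤ) : Frame p σ (σ.setArr a i z) :=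
  ⟨fun _ _ => rfl, fun b hb => funext fun j => by
    rw [RAMState.setArr_arr, if_neg (fun h : b = a ∧ j = i => hb (h.1 ▸ ha))]⟩

theorem of_exec {t : ℕ} (h : Exec p σ τ t) : Frame p σ τ := by
  induction h with
  | skip | loop_done => exact refl _ _
  | const | add | sub | load => exact setReg (List.mem_singleton_self _) _
  | store => exact setArr (List.mem_singleton_self _) _ _
  | seq _ _ _ _ _ _ _ _ _ ih₁ ih₂ =>
    exact (ih₁.mono (List.subset_append_left _ _) (List.subset_append_left _ _)).trans
      (ih₂.mono (List.subset_append_right _ _) (List.subset_append_right _ _))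
  | cond_pos _ _ _ _ _ _ _ _ ih =>
    exact ih.mono (List.subset_append_left _ _) (List.subset_append_left _ _)
  | cond_neg _ _ _ _ _ _ _ _ ih =>
    exact ih.mono (List.subset_append_right _ _) (List.subset_append_right _ _)
  | loop_step _ _ _ _ _ _ _ _ _ _ ih₁ ih₂ =>
    exact .trans (ih₁.mono (List.Subset.refl _) (List.Subset.refl _)) ih₂

end Frame

/-- The weakest precondition: started in `σ`, the program `p` halts in a state `τ` after `t` steps
with `Q τ t`. -/
def wp (p : RAMProg) (σ : RAMState) (Q : RAMState → ℕ → Prop) : Prop :=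
  ∃ τ t, Exec p σ τ t ∧ Q τ t

section WeakestPrecondition

variable {p q : RAMProg} {σ : RAMState} {Q R : RAMState → ℕ → Prop}

theorem wp_mono (h : wp p σ Q) (hQR : ∀ τ t, Frame p σ τ → Q τ t → R τ t) : wp p σ R := by
  obtain ⟨τ, t, he, hq⟩ := h
  exact ⟨τ, t, he, hQR τ t (Frame.of_exec he) hq⟩

@[simp] theorem wp_skip : wp .skip σ Q ↔ Q σ 1 :=
  ⟨by rintro ⟨_, _, ⟨⟩, h⟩; exact h, fun h => ⟨_, _, .skip σ, h⟩⟩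

@[simp] theorem wp_const {d : ℕ} {c : ℤ} : wp (.const d c) σ Q ↔ Q (σ.setReg d c) 1 :=
  ⟨by rintro ⟨_, _, ⟨⟩, h⟩; exact h, fun h => ⟨_, _, .const σ d c, h⟩⟩

@[simp] theorem wp_add {d a b : ℕ} :
    wp (.add d a b) σ Q ↔ Q (σ.setReg d (σ.reg a + σ.reg b)) 1 :=
  ⟨by rintro ⟨_, _, ⟨⟩, h⟩; exact h, fun h => ⟨_, _, .add σ d a b, h⟩⟩

@[simp] theorem wp_sub {d a b : ℕ} :
    wp (.sub d a b) σ Q ↔ Q (σ.setReg d (σ.reg a - σ.reg b)) 1 :=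
  ⟨by rintro ⟨_, _, ⟨⟩, h⟩; exact h, fun h => ⟨_, _, .sub σ d a b, h⟩⟩

@[simp] theorem wp_load {d a i : ℕ} :
    wp (.load d a i) σ Q ↔ Q (σ.setReg d (σ.arr a (σ.reg i).toNat)) 1 :=
  ⟨by rintro ⟨_, _, ⟨⟩, h⟩; exact h, fun h => ⟨_, _, .load σ d a i, h⟩⟩

@[simp] theorem wp_store {a i s : ℕ} :
    wp (.store a i s) σ Q ↔ Q (σ.setArr a (σ.reg i).toNat (σ.reg s)) 1 :=
  ⟨by rintro ⟨_, _, ⟨⟩, h⟩; exact h, fun h => ⟨_, _, .store σ a i s, h⟩⟩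

theorem wp_seq :
    wp (.seq p q) σ Q ↔ wp p σ fun ρ t₁ => wp q ρ fun τ t₂ => Q τ (t₁ + t₂) := by
  constructor
  · rintro ⟨τ, t, h, hQ⟩
    cases h with
    | seq _ _ _ ρ _ t₁ t₂ h₁ h₂ => exact ⟨ρ, t₁, h₁, τ, t₂, h₂, hQ⟩
  · rintro ⟨ρ, t₁, h₁, τ, t₂, h₂, hQ⟩
    exact ⟨τ, _, .seq _ _ _ _ _ _ _ h₁ h₂, hQ⟩

@[simp] theorem wp_block_singleton : wp (.block [p]) σ Q ↔ wp p σ Q := Iff.rfl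

@[simp] theorem wp_block_cons {l : List RAMProg} :
    wp (.block (p :: q :: l)) σ Q ↔
      wp p σ fun ρ t₁ => wp (.block (q :: l)) ρ fun τ t₂ => Q τ (t₁ + t₂) := wp_seq

@[simp] theorem wp_cond {a : ℕ} :
    wp (.cond a p q) σ Q ↔
      if 0 < σ.reg a then wp p σ fun τ t => Q τ (t + 1) else wp q σ fun τ t => Q τ (t + 1) := by
  split_ifs with ha <;> constructor
  · rintro ⟨τ, _, h, hQ⟩
    cases h with
    | cond_pos _ _ _ _ _ t _ h => exact ⟨τ, t, h, hQ⟩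
    | cond_neg _ _ _ _ _ _ hn _ => exact absurd ha hn
  · rintro ⟨τ, t, h, hQ⟩
    exact ⟨τ, _, .cond_pos _ _ _ _ _ _ ha h, hQ⟩
  · rintro ⟨τ, _, h, hQ⟩
    cases h with
    | cond_pos _ _ _ _ _ _ hp _ => exact absurd hp ha
    | cond_neg _ _ _ _ _ t _ h => exact ⟨τ, t, h, hQ⟩
  · rintro ⟨τ, t, h, hQ⟩
    exact ⟨τ, _, .cond_neg _ _ _ _ _ _ ha h, hQ⟩

end WeakestPrecondition

section ForLoop

open RAMProg (oneReg)

variable {c : ℕ} {body : RAMProg} {σ : RAMState} {Q : RAMState → ℕ → Prop}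

theorem exec_forDown_decrement {ρ τ : RAMState} {i t : ℕ} (hone : ρ.reg oneReg = 1)
    (hc : ρ.reg c = (i + 1 : ℕ)) (h : Exec body (ρ.setReg c i) τ t) :
    Exec (.seq (.sub c c oneReg) body) ρ τ (1 + t) := by
  refine .seq _ _ _ (ρ.setReg c i) _ _ _ ?_ h
  have hsub := Exec.sub ρ c c oneReg
  rwa [hc, hone, Nat.cast_succ, add_sub_cancel_right] at hsub

/-- In the invariant `I i ρ s`, the values below `i` are still to be processed, and `s` steps have
been made so far. -/
theorem wp_forDown_elapsed (k : ℕ) (I : ℕ → RAMState → ℕ → Prop) (hk : σ.reg c = k)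
    (hone : σ.reg oneReg = 1) (hI : I k σ 0)
    (step : ∀ i < k, ∀ ρ s, Frame (.forDown c body) σ ρ → I (i + 1) ρ s →
      wp body (ρ.setReg c i) fun τ t => I i τ (s + t + 2))
    (post : ∀ τ t, Frame (.forDown c body) σ τ → I 0 τ t → Q τ (t + 1))
    (hc : c ∉ body.regs := by decide) (hone_notMem : oneReg ∉ c :: body.regs := by decide) :
    wp (.forDown c body) σ Q := by
  suffices H : ∀ j ≤ k, ∀ ρ s, Frame (.forDown c body) σ ρ → ρ.reg c = j → I j ρ s →
      wp (.forDown c body) ρ fun τ t => Q τ (s + t) by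
    simpa only [zero_add] using H k le_rfl σ 0 (Frame.refl _ _) hk hI
  intro j
  induction j with
  | zero =>
    intro _ ρ s hF hr hI
    exact ⟨ρ, 1, .loop_done _ _ _ (by rw [hr]; exact lt_irrefl _), post ρ s hF hI⟩
  | succ i ih =>
    intro hi ρ s hF hr hI
    obtain ⟨τ, t, hbody, hIτ⟩ := step i hi ρ s hF hI
    have honeρ : ρ.reg oneReg = 1 := (hF.reg _ hone_notMem).trans hone
    have hiter := exec_forDown_decrement honeρ hr hbody
    have hτc : τ.reg c = i := by
      rw [(Frame.of_exec hbody).reg c hc, RAMState.setReg_reg, if_pos rfl]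
    have hFτ : Frame (.forDown c body) σ τ :=
      hF.trans ((Frame.of_exec hiter).mono (List.Subset.refl _) (List.Subset.refl _))
    obtain ⟨τ', t', hrest, hQ⟩ := ih (by omega) τ _ hFτ hτc hIτ
    refine ⟨τ', _, .loop_step _ _ _ _ _ _ _ (by rw [hr]; positivity) hiter hrest, ?_⟩
    have hst : s + (1 + t + t' + 1) = s + t + 2 + t' := by omega
    rwa [← hst] at hQ

theorem wp_forDown (k T : ℕ) (I : ℕ → RAMState → Prop) (hk : σ.reg c = k)
    (hone : σ.reg oneReg = 1) (hI : I k σ)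
    (step : ∀ i < k, ∀ ρ, Frame (.forDown c body) σ ρ → I (i + 1) ρ →
      wp body (ρ.setReg c i) fun τ t => t ≤ T ∧ I i τ)
    (post : ∀ τ t, Frame (.forDown c body) σ τ → I 0 τ → t ≤ k * (T + 2) + 1 → Q τ t)
    (hc : c ∉ body.regs := by decide) (hone_notMem : oneReg ∉ c :: body.regs := by decide) :
    wp (.forDown c body) σ Q := by
  refine wp_forDown_elapsed k (fun i ρ s => i ≤ k ∧ I i ρ ∧ s ≤ (k - i) * (T + 2)) hk hone
    ⟨le_rfl, hI, Nat.zero_le _⟩ ?_ ?_ hc hone_notMem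
  · rintro i hi ρ s hF ⟨-, hI, hs⟩
    refine wp_mono (step i hi ρ hF hI) fun τ t _ ⟨_, hτ⟩ => ⟨hi.le, hτ, ?_⟩
    rw [show k - i = k - (i + 1) + 1 by omega, Nat.succ_mul]
    omega
  · rintro τ t hF ⟨-, hI, ht⟩
    exact post τ _ hF hI (Nat.add_le_add_right ht 1)

theorem wp_addMul {d a c : ℕ} (k : ℕ) (hk : σ.reg c = k) (hone : σ.reg oneReg = 1)
    (post : ∀ τ t, Frame (.addMul d a c) σ τ → τ.reg d = σ.reg d + k * σ.reg a →
      t ≤ 3 * k + 1 → Q τ t)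
    (hne : [c, d, a, oneReg].Nodup := by decide) :
    wp (.addMul d a c) σ Q := by
  simp only [List.nodup_cons, List.mem_cons, List.not_mem_nil, or_false, not_or] at hne
  obtain ⟨⟨hcd, hca, hc1⟩, ⟨hda, hd1⟩, -, -⟩ := hne
  refine wp_forDown k 1 (fun i ρ => ρ.reg d = σ.reg d + ((k : ℤ) - i) * σ.reg a) hk hone
    (by simp) ?_ ?_ (by simpa [RAMProg.regs] using hcd)
    (by simpa [RAMProg.regs, eq_comm] using ⟨hc1, hd1⟩)
  · intro i _ ρ hF hI
    have ha : ρ.reg a = σ.reg a :=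
      hF.reg a (by simp [RAMProg.forDown, RAMProg.regs, Ne.symm hca, Ne.symm hda])
    rw [wp_add]
    refine ⟨le_rfl, ?_⟩
    simp only [RAMState.setReg_reg, if_true, Ne.symm hcd, Ne.symm hca, if_false, hI, ha]
    push_cast
    ring
  · intro τ t hF hI ht
    exact post τ t hF (by simpa using hI) (by omega)

end ForLoop

/-! ### Rooted trees -/

namespace HostTree

variable {N : ℕ} (T : HostTree N)

/-- The distance of a node from the root. -/
def depth (x : Fin N) : ℕ := Nat.find (T.reaches_root x)

theorem iterate_root (k : ℕ) : T.parent^[k] T.root = T.root :=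
  Function.iterate_fixed T.parent_root k

theorem iterate_eq_root_iff {x : Fin N} {k : ℕ} : T.parent^[k] x = T.root ↔ T.depth x ≤ k := by
  constructor
  · exact fun h => Nat.find_min' _ h
  · intro h
    obtain ⟨j, rfl⟩ := Nat.exists_eq_add_of_le h
    rw [add_comm, Function.iterate_add_apply, depth, Nat.find_spec (T.reaches_root x),
      iterate_root]

theorem depth_iterate (x : Fin N) (k : ℕ) : T.depth (T.parent^[k] x) = T.depth x - k := by
  refine le_antisymm ?_ ?_
  · rw [← iterate_eq_root_iff, ← Function.iterate_add_apply, iterate_eq_root_iff]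
    omega
  · have h := (T.iterate_eq_root_iff (x := T.parent^[k] x)).2 le_rfl
    rw [← Function.iterate_add_apply, iterate_eq_root_iff] at h
    omega

theorem depth_parent (x : Fin N) : T.depth (T.parent x) = T.depth x - 1 := T.depth_iterate x 1

theorem depth_eq_zero {x : Fin N} : T.depth x = 0 ↔ x = T.root := by
  rw [← Nat.le_zero, ← iterate_eq_root_iff, Function.iterate_zero, id]

theorem depth_lt (x : Fin N) : T.depth x < N := by
  have hinj : Function.Injective fun k : Fin (T.depth x + 1) => T.parent^[k] x := by
    intro a b hab
    have h := congrArg T.depth hab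
    simp only [depth_iterate] at h
    ext
    omega
  simpa using Fintype.card_le_of_injective _ hinj

variable {T}

theorem depth_parent_lt {x : Fin N} (hx : x ≠ T.root) : T.depth (T.parent x) < T.depth x := by
  have := mt T.depth_eq_zero.1 hx
  rw [depth_parent]
  omega

theorem desc_root (x : Fin N) : T.Desc x T.root := T.reaches_root x

theorem Desc.refl (x : Fin N) : T.Desc x x := ⟨0, rfl⟩

theorem Desc.trans {x y z : Fin N} (h₁ : T.Desc x y) (h₂ : T.Desc y z) : T.Desc x z := by
  obtain ⟨j, rfl⟩ := h₁
  obtain ⟨k, rfl⟩ := h₂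
  exact ⟨k + j, Function.iterate_add_apply _ _ _ _⟩

theorem Desc.depth_le {x y : Fin N} (h : T.Desc x y) : T.depth y ≤ T.depth x := by
  obtain ⟨k, rfl⟩ := h
  rw [depth_iterate]
  omega

theorem Desc.iterate_eq {x y : Fin N} (h : T.Desc x y) :
    T.parent^[T.depth x - T.depth y] x = y := by
  obtain ⟨k, rfl⟩ := h
  rw [depth_iterate]
  by_cases hk : k ≤ T.depth x
  · rw [Nat.sub_sub_self hk]
  · rw [Nat.sub_eq_zero_of_le (by omega : T.depth x ≤ k), Nat.sub_zero,
      T.iterate_eq_root_iff.2 le_rfl, T.iterate_eq_root_iff.2 (by omega : T.depth x ≤ k)]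

theorem Desc.of_depth_le {p x y : Fin N} (hx : T.Desc p x) (hy : T.Desc p y)
    (h : T.depth x ≤ T.depth y) : T.Desc y x := by
  refine ⟨T.depth y - T.depth x, ?_⟩
  have h₁ := hx.iterate_eq
  have h₂ := hy.iterate_eq
  have h₃ := hy.depth_le
  rw [← h₂, ← Function.iterate_add_apply, h₂, ← h₁]
  congr 1
  rw [h₁]
  omega

theorem Desc.of_adj {u v t : Fin N} (hu : T.Desc u t) (h : T.graph.Adj u v) :
    T.Desc v t ∨ u = t ∧ v = T.parent t := by
  rcases (SimpleGraph.fromRel_adj _ _ _).1 h with ⟨-, hpar | hpar⟩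
  · obtain ⟨k, hk⟩ := hu
    cases k with
    | zero => exact .inr ⟨hk, by rw [← hpar, show u = t from hk]⟩
    | succ k => exact .inl ⟨k, by rwa [← hpar, ← Function.iterate_succ_apply]⟩
  · exact .inl (Desc.trans ⟨1, hpar⟩ hu)

theorem IsSubtree.desc_of_parent_notMem {s : Set (Fin N)} (hs : T.IsSubtree s) {t : Fin N}
    (ht : t ∈ s) (hp : T.parent t ∈ s → T.parent t = t) {x : Fin N} (hx : x ∈ s) :
    T.Desc x t := by
  obtain ⟨w⟩ := hs.preconnected ⟨t, ht⟩ ⟨x, hx⟩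
  suffices H : ∀ {a b : s}, (T.graph.induce s).Walk a b → T.Desc a t → T.Desc b t from
    H w (Desc.refl t)
  intro a b w
  induction w with
  | nil => exact id
  | @cons _ v _ hadj _ ih =>
    intro hu
    refine ih ?_
    rcases hu.of_adj (v := (v : Fin N)) hadj with hv | ⟨-, hv⟩
    · exact hv
    · rw [hv, hp (hv ▸ v.2)]
      exact Desc.refl t

theorem IsSubtree.parent_mem {s : Set (Fin N)} (hs : T.IsSubtree s) {x t : Fin N} (hx : x ∈ s)
    (ht : t ∈ s) (h : T.depth t < T.depth x) : T.parent x ∈ s := by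
  by_contra hp
  have := (hs.desc_of_parent_notMem hx (fun h' => absurd h' hp) ht).depth_le
  omega

variable (T) in
/-- The least depth of a node of `s`. -/
noncomputable def minDepth (s : Set (Fin N)) : ℕ := sInf (T.depth '' s)

theorem minDepth_le {s : Set (Fin N)} {x : Fin N} (hx : x ∈ s) : T.minDepth s ≤ T.depth x :=
  Nat.sInf_le (Set.mem_image_of_mem _ hx)

theorem IsSubtree.nonempty {s : Set (Fin N)} (hs : T.IsSubtree s) : s.Nonempty :=
  Set.nonempty_coe_sort.1 (SimpleGraph.Connected.nonempty hs)

theorem IsSubtree.exists_isRootOf {s : Set (Fin N)} (hs : T.IsSubtree s) :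
    ∃ t, T.IsRootOf s t ∧ T.depth t = T.minDepth s := by
  obtain ⟨t, ht, htd⟩ := Nat.sInf_mem (hs.nonempty.image T.depth)
  refine ⟨t, ⟨ht, fun x hx => hs.desc_of_parent_notMem ht (fun hp => ?_) hx⟩, htd⟩
  have h₁ : T.minDepth s ≤ T.depth (T.parent t) := minDepth_le hp
  rw [depth_parent, minDepth, ← htd] at h₁
  have h₂ : t = T.root := T.depth_eq_zero.1 (by omega)
  rw [h₂, T.parent_root]

theorem IsSubtree.mem_of_desc {s : Set (Fin N)} (hs : T.IsSubtree s) {x y : Fin N} (hy : y ∈ s)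
    (hyx : T.Desc y x) (hx : T.minDepth s ≤ T.depth x) : x ∈ s := by
  obtain ⟨t, ⟨ht, _⟩, htd⟩ := hs.exists_isRootOf
  obtain ⟨k, rfl⟩ := hyx
  induction k generalizing y with
  | zero => exact hy
  | succ k ih =>
    rw [Function.iterate_succ_apply] at hx ⊢
    by_cases h : T.depth t < T.depth y
    · exact ih (hs.parent_mem hy ht h) hx
    · rw [← Function.iterate_succ_apply, depth_iterate] at hx
      have : y = T.root := T.depth_eq_zero.1 (by
        have := minDepth_le (T := T) hy
        omega)
      subst this
      rwa [T.parent_root, iterate_root]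

open Classical in
variable (T) in
/-- One more than the greatest depth of a node of `s` on the path from `p` to the root, and `0` if
there is none. -/
noncomputable def reach (s : Set (Fin N)) (p : Fin N) : ℕ :=
  (Finset.range N).sup fun k => if T.parent^[k] p ∈ s then T.depth (T.parent^[k] p) + 1 else 0

theorem lt_reach_iff {s : Set (Fin N)} {p : Fin N} {m : ℕ} :
    m < T.reach s p ↔ ∃ y ∈ s, T.Desc p y ∧ m ≤ T.depth y := by
  rw [reach, Finset.lt_sup_iff]
  constructor
  · rintro ⟨k, _, hk⟩
    split_ifs at hk with h
    · exact ⟨_, h, ⟨k, rfl⟩, by omega⟩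
    · omega
  · rintro ⟨y, hy, hpy, hm⟩
    have := T.depth_lt p
    refine ⟨T.depth p - T.depth y, Finset.mem_range.2 (by omega), ?_⟩
    rw [hpy.iterate_eq, if_pos hy]
    omega

theorem reach_le (s : Set (Fin N)) (p : Fin N) : T.reach s p ≤ N := by
  by_contra h
  obtain ⟨y, _, _, hy⟩ := lt_reach_iff.1 (not_le.1 h)
  have := T.depth_lt y
  omega

theorem IsSubtree.mem_iff_lt_reach {s : Set (Fin N)} (hs : T.IsSubtree s) {p x : Fin N}
    (hpx : T.Desc p x) (hx : T.minDepth s ≤ T.depth x) : x ∈ s ↔ T.depth x < T.reach s p := by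
  rw [lt_reach_iff]
  constructor
  · exact fun h => ⟨x, h, hpx, le_rfl⟩
  · rintro ⟨y, hy, hpy, h⟩
    exact hs.mem_of_desc hy (hpx.of_depth_le hpy h) hx

theorem IsRootOf.desc_of_reach_pos {s : Set (Fin N)} {t p : Fin N} (ht : T.IsRootOf s t)
    (h : 0 < T.reach s p) : T.Desc p t := by
  obtain ⟨y, hy, hpy, _⟩ := lt_reach_iff.1 h
  exact hpy.trans (ht.2 y hy)

/-- A tip is a node without children. In a tree with at least two nodes, the tips are the leaves. -/
def IsTip (T : HostTree N) (p : Fin N) : Prop := ∀ y, T.parent y ≠ p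

theorem isLeafOf_univ_iff {p : Fin N} : T.IsLeafOf Set.univ p ↔ T.IsTip p := by
  constructor
  · exact fun h y => h.2.2 y trivial
  · refine fun h => ⟨trivial, fun hr => ?_, fun y _ => h y⟩
    obtain ⟨k, hk⟩ := hr.2 T.root trivial
    rw [iterate_root] at hk
    exact h T.root (T.parent_root.trans hk)

theorem exists_tip_desc (hN : 1 < N) (x : Fin N) : ∃ p, T.IsTip p ∧ T.Desc p x := by
  classical
  obtain ⟨p, hp, hmax⟩ := (Finset.univ.filter fun y => T.Desc y x).exists_max_image T.depth
    ⟨x, Finset.mem_filter.2 ⟨Finset.mem_univ _, Desc.refl x⟩⟩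
  simp only [Finset.mem_filter, Finset.mem_univ, true_and] at hp hmax
  refine ⟨p, fun y hy => ?_, hp⟩
  have hy_root : y = T.root := by
    by_contra hne
    exact (depth_parent_lt hne).not_ge (hy ▸ hmax y (Desc.trans ⟨1, hy⟩ hp))
  have hp_zero : T.depth p = 0 := by rw [depth_eq_zero, ← hy, hy_root, parent_root]
  have hx_root : x = T.root := T.depth_eq_zero.1 (Nat.le_zero.1 (hp_zero ▸ hp.depth_le))
  have : Nontrivial (Fin N) := Fin.nontrivial_iff_two_le.2 hN
  obtain ⟨u, hu⟩ := exists_ne T.root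
  exact hu (T.depth_eq_zero.1 (Nat.le_zero.1 (hp_zero ▸ hmax u (hx_root ▸ desc_root u))))

end HostTree

/-! ### Cycles and triangles in chordal graphs -/

section Cycles

variable {V α : Type*} [LinearOrder α] {G : SimpleGraph V} {lev : V → α}

/-- A perfect elimination ordering, as a level function with ties allowed: the neighbours of a
vertex that are of no greater level are pairwise adjacent. -/
def IsPerfectElimination (G : SimpleGraph V) (lev : V → α) : Prop :=
  ∀ ⦃a b v⦄, a ≠ b → G.Adj a v → G.Adj b v → lev a ≤ lev v → lev b ≤ lev v → G.Adj a b

/-- The relation whose chains are the walks within `Y`. -/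
def AdjIn (G : SimpleGraph V) (Y : Finset V) (a b : V) : Prop := a ∈ Y ∧ b ∈ Y ∧ G.Adj a b

open Relation

theorem reflTransGen_adjIn_of_walk {Y : Finset V} {a b : V} (p : G.Walk a b)
    (h : ∀ x ∈ p.support, x ∈ Y) : ReflTransGen (AdjIn G Y) a b := by
  induction p with
  | nil => exact .refl
  | cons hadj p ih =>
    have hp : ∀ x ∈ p.support, x ∈ Y := fun x hx => h x (List.mem_cons_of_mem _ hx)
    exact .head ⟨h _ (SimpleGraph.Walk.start_mem_support _), hp _ p.start_mem_support, hadj⟩ (ih hp)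

/-- A detour through `v` is cut short by the edge between its two neighbours on the chain. The
second half of the conclusion makes the induction work when the chain starts at `v`. -/
theorem reflTransGen_adjIn_erase [DecidableEq V] {Y : Finset V} {v : V}
    (hv : ∀ a ∈ Y, ∀ b ∈ Y, G.Adj a v → G.Adj b v → a ≠ b → G.Adj a b) {a w : V}
    (h : ReflTransGen (AdjIn G Y) a w) (hw : w ≠ v) :
    (a ≠ v → ReflTransGen (AdjIn G (Y.erase v)) a w) ∧
    (a = v → ∀ b ∈ Y, G.Adj b v → ReflTransGen (AdjIn G (Y.erase v)) b w) := by
  induction h using ReflTransGen.head_induction_on with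
  | refl => exact ⟨fun _ => .refl, fun h => absurd h hw⟩
  | @head a c hac _ ih =>
    obtain ⟨haY, hcY, hadj⟩ := hac
    refine ⟨fun hav => ?_, ?_⟩
    · by_cases hcv : c = v
      · exact ih.2 hcv a haY (hcv ▸ hadj)
      · exact .head ⟨Finset.mem_erase.2 ⟨hav, haY⟩, Finset.mem_erase.2 ⟨hcv, hcY⟩, hadj⟩
          (ih.1 hcv)
    · rintro rfl b hbY hb
      by_cases hbc : b = c
      · exact hbc ▸ ih.1 hadj.ne'
      · exact .head ⟨Finset.mem_erase.2 ⟨hb.ne, hbY⟩, Finset.mem_erase.2 ⟨hadj.ne', hcY⟩,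
          hv b hbY c hcY hb hadj.symm hbc⟩ (ih.1 hadj.ne')

theorem exists_adjIn_of_reflTransGen {Y : Finset V} {u w : V} (huw : u ≠ w)
    (h : ReflTransGen (AdjIn G Y) u w) :
    (∃ c ∈ Y, G.Adj u c) ∧ ∃ c ∈ Y, G.Adj w c := by
  constructor
  · obtain rfl | ⟨c, ⟨-, hc, huc⟩, -⟩ := ReflTransGen.cases_head h
    exacts [absurd rfl huw, ⟨c, hc, huc⟩]
  · obtain rfl | ⟨c, -, hc, -, hcw⟩ := ReflTransGen.cases_tail h
    exacts [absurd rfl huw, ⟨c, hc, hcw.symm⟩]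

namespace IsPerfectElimination

/-- Induction on `Y`: eliminate a vertex `v` of greatest level, whose neighbours form a clique. If
`v` is `s`, `u` or `w`, then this clique contains the triangle. -/
theorem exists_adj_neighbors (hG : IsPerfectElimination G lev) {s u w : V} {Y : Finset V}
    (hs : s ∉ Y) (hu : u ∈ Y) (hw : w ∈ Y) (huw : u ≠ w) (hsu : G.Adj s u) (hsw : G.Adj s w)
    (h : ReflTransGen (AdjIn G Y) u w) :
    ∃ a ∈ Y, ∃ b ∈ Y, G.Adj s a ∧ G.Adj s b ∧ G.Adj a b := by
  classical
  induction Y using Finset.strongInduction with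
  | H Y ih =>
    obtain ⟨v, hv, hmax⟩ := (insert s Y).exists_max_image lev ⟨s, Finset.mem_insert_self _ _⟩
    rw [Finset.forall_mem_insert] at hmax
    rcases Finset.mem_insert.1 hv with rfl | hvY
    · exact ⟨u, hu, w, hw, hsu, hsw, hG huw hsu.symm hsw.symm (hmax.2 u hu) (hmax.2 w hw)⟩
    by_cases hsv : G.Adj s v ∧ ∃ c ∈ Y, G.Adj v c
    · obtain ⟨hsv, c, hc, hvc⟩ := hsv
      exact ⟨v, hvY, c, hc, hsv,
        hG (fun h => hs (h ▸ hc)) hsv hvc.symm hmax.1 (hmax.2 c hc), hvc⟩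
    have huv : u ≠ v := fun e => hsv ⟨e ▸ hsu, e ▸ (exists_adjIn_of_reflTransGen huw h).1⟩
    have hwv : w ≠ v := fun e => hsv ⟨e ▸ hsw, e ▸ (exists_adjIn_of_reflTransGen huw h).2⟩
    have h_erase := (reflTransGen_adjIn_erase (fun a ha b hb hav hbv hab =>
      hG hab hav hbv (hmax.2 a ha) (hmax.2 b hb)) h hwv).1 huv
    obtain ⟨a, ha, b, hb, hab⟩ := ih _ (Finset.erase_ssubset hvY)
      (mt Finset.mem_of_mem_erase hs) (Finset.mem_erase.2 ⟨huv, hu⟩)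
      (Finset.mem_erase.2 ⟨hwv, hw⟩) h_erase
    exact ⟨a, Finset.mem_of_mem_erase ha, b, Finset.mem_of_mem_erase hb, hab⟩

theorem exists_triangle_of_isCycle (hG : IsPerfectElimination G lev) {s : V} {c : G.Walk s s}
    (hc : c.IsCycle) :
    ∃ a ∈ c.support, ∃ b ∈ c.support, G.Adj s a ∧ G.Adj s b ∧ G.Adj a b := by
  classical
  have htail : ¬ c.tail.Nil := by
    have := hc.three_le_length
    have := SimpleGraph.Walk.length_tail_add_one hc.not_nil
    rw [← SimpleGraph.Walk.length_eq_zero_iff]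
    omega
  have hne : c.snd ≠ c.tail.penultimate := by
    have := SimpleGraph.Walk.penultimate_cons_of_not_nil (c.adj_snd hc.not_nil) c.tail htail
    rw [c.cons_tail_eq hc.not_nil] at this
    exact this ▸ hc.snd_ne_penultimate
  have hs : s ∉ c.tail.dropLast.support := by
    have hpath := hc.isPath_tail
    rw [← c.tail.concat_dropLast (SimpleGraph.Walk.adj_penultimate htail),
      SimpleGraph.Walk.concat_isPath_iff] at hpath
    exact hpath.2
  have hmem : ∀ x ∈ c.tail.dropLast.support, x ∈ c.tail.dropLast.support.toFinset :=
    fun _ => List.mem_toFinset.2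
  obtain ⟨a, ha, b, hb, hab⟩ := hG.exists_adj_neighbors (mt List.mem_toFinset.1 hs)
    (hmem _ (SimpleGraph.Walk.start_mem_support _)) (hmem _ (SimpleGraph.Walk.end_mem_support _))
    hne (c.adj_snd hc.not_nil)
    (SimpleGraph.Walk.adj_penultimate htail).symm (reflTransGen_adjIn_of_walk _ hmem)
  have hsub : c.tail.dropLast.support ⊆ c.support :=
    c.isSubwalk_rfl.tail.dropLast.support_subset
  exact ⟨a, hsub (List.mem_toFinset.1 ha), b, hsub (List.mem_toFinset.1 hb), hab⟩

end IsPerfectElimination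

/-- No triangle within `Y` contains a vertex of `S`. -/
def NoTerminalTriangle (G : SimpleGraph V) (S Y : Finset V) : Prop :=
  ∀ a ∈ Y, ∀ b ∈ Y, ∀ c ∈ Y, a ∈ S → G.Adj a b → G.Adj b c → G.Adj a c → False

end Cycles

theorem isSubsetFVS_iff {n : ℕ} {G : SimpleGraph (Fin n)} {α : Type*} [LinearOrder α]
    {lev : Fin n → α} (hG : IsPerfectElimination G lev) (S X : Finset (Fin n)) :
    IsSubsetFVS G S X ↔ NoTerminalTriangle G S Xᶜ := by
  constructor
  · intro h a ha b hb c hc haS hab hbc hac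
    rw [Finset.mem_compl] at ha hb hc
    obtain ⟨x, hx, hxs⟩ := h a (.cons hab (.cons hbc (.cons hac.symm .nil))) (by
      simp [SimpleGraph.Walk.isCycle_def, SimpleGraph.Walk.isTrail_def, hab.ne, hab.ne',
        hbc.ne, hac.ne, hac.ne']) ⟨a, haS, SimpleGraph.Walk.start_mem_support _⟩
    simp only [SimpleGraph.Walk.support_cons, SimpleGraph.Walk.support_nil, List.mem_cons,
      List.not_mem_nil, or_false] at hxs
    rcases hxs with rfl | rfl | rfl | rfl
    all_goals contradiction
  · rintro h v c hc ⟨s, hsS, hsc⟩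
    by_contra! hX
    have hXc : ∀ x ∈ (c.rotate s hsc).support, x ∈ Xᶜ := fun x hx => Finset.mem_compl.2 fun hxX =>
      hX x hxX ((SimpleGraph.Walk.mem_support_rotate_iff c s hsc).1 hx)
    obtain ⟨a, ha, b, hb, hsa, hsb, hab⟩ := hG.exists_triangle_of_isCycle (hc.rotate hsc)
    exact h s (hXc s (SimpleGraph.Walk.start_mem_support _)) a (hXc a ha) b (hXc b hb) hsS hsa hab
      hsb

namespace TreeModel

variable {n : ℕ} {G : SimpleGraph (Fin n)} {N : ℕ} (M : TreeModel G N)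

/-- The depth of the root of the subtree of `v`. -/
noncomputable def level (v : Fin n) : ℕ := M.host.minDepth (M.sub v)

theorem level_lt (v : Fin n) : M.level v < N := by
  obtain ⟨t, -, htd⟩ := (M.isSubtree v).exists_isRootOf
  exact htd.symm.trans_lt (M.host.depth_lt t)

variable {M}

theorem isRootOf_mem_of_adj {u v : Fin n} {t : Fin N} (ht : M.host.IsRootOf (M.sub v) t)
    (htd : M.host.depth t = M.level v) (hadj : G.Adj u v) (h : M.level u ≤ M.level v) :
    t ∈ M.sub u := by
  obtain ⟨y, hyu, hyv⟩ := (M.adj_iff u v hadj.ne).1 hadj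
  exact (M.isSubtree u).mem_of_desc hyu (ht.2 y hyv) (h.trans htd.ge)

variable (M) in
theorem isPerfectElimination_level : IsPerfectElimination G M.level := by
  intro a b v hab ha hb hla hlb
  obtain ⟨t, ht, htd⟩ := (M.isSubtree v).exists_isRootOf
  exact (M.adj_iff a b hab).2
    ⟨t, isRootOf_mem_of_adj ht htd ha hla, isRootOf_mem_of_adj ht htd hb hlb⟩

end TreeModel

/-! ### The two largest labels -/

/-- `s` consists of the two largest values of `z` on `Y` (or `0` in place of missing ones). -/
structure IsTopTwo {V : Type*} (Y : Finset V) (z : V → ℕ) (s : ℕ × ℕ) : Prop where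
  snd_le_fst : s.2 ≤ s.1
  le_fst : ∀ a ∈ Y, z a ≤ s.1
  le_snd : ∀ a ∈ Y, ∀ b ∈ Y, a ≠ b → min (z a) (z b) ≤ s.2
  fst_eq : 0 < s.1 → ∃ a ∈ Y, z a = s.1
  snd_eq : 0 < s.2 → ∃ a ∈ Y, ∃ b ∈ Y, a ≠ b ∧ z a = s.1 ∧ z b = s.2

/-- Insert a label into a pair of largest labels. -/
def insertLabel (z : ℕ) (s : ℕ × ℕ) : ℕ × ℕ := (max s.1 z, max s.2 (min s.1 z))

theorem insertLabel_lt {B z : ℕ} {s : ℕ × ℕ} (hz : z < B) (hs : s.1 < B ∧ s.2 < B) :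
    (insertLabel z s).1 < B ∧ (insertLabel z s).2 < B := by
  simp only [insertLabel]
  omega

namespace IsTopTwo

variable {V : Type*} {Y : Finset V} {z : V → ℕ} {s : ℕ × ℕ}

theorem empty (z : V → ℕ) : IsTopTwo ∅ z (0, 0) :=
  ⟨le_rfl, by simp, by simp, by simp, by simp⟩

theorem insert [DecidableEq V] (h : IsTopTwo Y z s) {v : V} (hv : v ∉ Y) :
    IsTopTwo (insert v Y) z (insertLabel (z v) s) := by
  obtain ⟨d, e⟩ := s
  obtain ⟨h₀, h₁, h₂, h₃, h₄⟩ := h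
  constructor <;> grind [insertLabel]

theorem lt (h : IsTopTwo Y z s) {B : ℕ} (hB : 0 < B) (hz : ∀ a ∈ Y, z a < B) :
    s.1 < B ∧ s.2 < B := by
  have hfst : s.1 < B := by
    rcases Nat.eq_zero_or_pos s.1 with h₀ | h₀
    · omega
    · obtain ⟨a, ha, has⟩ := h.fst_eq h₀
      exact has ▸ hz a ha
  exact ⟨hfst, h.snd_le_fst.trans_lt hfst⟩

end IsTopTwo

/-! ### Codes of states -/

/-- The condition under which a vertex `v` with label `z` may not be chosen, if `s` are the two
largest labels so far. Here `c` is `1` if `v` is a terminal and `0` otherwise, the labels above `m`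
are those of the vertices whose subtrees contain the root of the subtree of `v`, and the labels of
the terminals are odd. -/
def Blocked (m c z : ℕ) (s : ℕ × ℕ) : Prop := 0 < z ∧ m < s.2 ∧ 0 < c + s.1 % 2 + s.2 % 2

instance (m c z : ℕ) (s : ℕ × ℕ) : Decidable (Blocked m c z s) :=
  inferInstanceAs (Decidable (_ ∧ _ ∧ _))

/-- The code of a pair of numbers below `B`. -/
def encodePair (B : ℕ) (s : ℕ × ℕ) : ℕ := s.1 * B + s.2

/-- The pair with a given code. -/
def decodePair (B q : ℕ) : ℕ × ℕ := (q / B, q % B)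

/-- The number of codes for `m` pairs of numbers below `B`. -/
def numCodes (B m : ℕ) : ℕ := (B * B) ^ m

section Codes

variable {ι : Type*} (B : ℕ)

/-- A family of pairs of numbers below `B`, indexed by a list, encoded as one number: the pairs are
digits in base `B * B`, the most significant one first. -/
def encodeState (s : ι → ℕ × ℕ) : List ι → ℕ
  | [] => 0
  | p :: l => encodePair B (s p) * numCodes B l.length + encodeState s l

/-- A pair's contribution to the code of the next state: the code of the pair after the insertion of
the label `z`, weighted with `L`, or `W` if the insertion is blocked. -/
def nextDigit (W m c z L : ℕ) (s : ℕ × ℕ) : ℕ :=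
  if Blocked m c z s then W else encodePair B (insertLabel z s) * L

/-- The code of the state after the insertion of a vertex with the labels `z`, and a number not
less than `W` if the insertion is blocked. -/
def nextCode (W m c : ℕ) (z : ι → ℕ) : List ι → ℕ → ℕ
  | [], _ => 0
  | p :: l, k =>
    nextDigit B W m c (z p) (numCodes B l.length) (decodePair B (k / numCodes B l.length)) +
      nextCode W m c z l (k % numCodes B l.length)

variable {B}

theorem mul_add_div_of_lt {a b c : ℕ} (h : c < b) : (a * b + c) / b = a := by
  rw [add_comm, Nat.add_mul_div_right _ _ (Nat.zero_lt_of_lt h), Nat.div_eq_of_lt h, zero_add]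

theorem numCodes_succ (m : ℕ) : numCodes B (m + 1) = B * B * numCodes B m := pow_succ' _ _

theorem encodePair_lt {s : ℕ × ℕ} (hs : s.1 < B ∧ s.2 < B) : encodePair B s < B * B :=
  calc s.1 * B + s.2 < (s.1 + 1) * B := by rw [Nat.succ_mul]; omega
    _ ≤ B * B := Nat.mul_le_mul_right _ hs.1

theorem decodePair_encodePair {s : ℕ × ℕ} (hs : s.2 < B) : decodePair B (encodePair B s) = s := by
  rw [decodePair, encodePair, mul_add_div_of_lt hs, Nat.mul_add_mod_of_lt hs]

theorem encodeState_zero (l : List ι) : encodeState B (fun _ => (0, 0)) l = 0 := by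
  induction l with
  | nil => rfl
  | cons p l ih => simp only [encodeState, ih, encodePair, zero_mul, add_zero]

variable {s : ι → ℕ × ℕ} (hs : ∀ p, (s p).1 < B ∧ (s p).2 < B)

include hs

theorem encodeState_lt (l : List ι) : encodeState B s l < numCodes B l.length := by
  induction l with
  | nil => exact Nat.one_pos
  | cons p l ih =>
    calc encodePair B (s p) * numCodes B l.length + encodeState B s l
      _ < (encodePair B (s p) + 1) * numCodes B l.length := by rw [Nat.succ_mul]; omega
      _ ≤ B * B * numCodes B l.length := Nat.mul_le_mul_right _ (encodePair_lt (hs p))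
      _ = numCodes B (l.length + 1) := (numCodes_succ _).symm

theorem encodeState_cons_div (p : ι) (l : List ι) :
    encodeState B s (p :: l) / numCodes B l.length = encodePair B (s p) :=
  mul_add_div_of_lt (encodeState_lt hs l)

theorem encodeState_cons_mod (p : ι) (l : List ι) :
    encodeState B s (p :: l) % numCodes B l.length = encodeState B s l :=
  Nat.mul_add_mod_of_lt (encodeState_lt hs l)

theorem nextCode_encodeState {W m c : ℕ} {z : ι → ℕ} {l : List ι}
    (h : ∀ p ∈ l, ¬ Blocked m c (z p) (s p)) :
    nextCode B W m c z l (encodeState B s l) =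
      encodeState B (fun p => insertLabel (z p) (s p)) l := by
  induction l with
  | nil => rfl
  | cons p l ih =>
    rw [List.forall_mem_cons] at h
    rw [nextCode, encodeState_cons_div hs, encodeState_cons_mod hs,
      decodePair_encodePair (hs p).2, nextDigit, if_neg h.1, ih h.2, encodeState]

theorem le_nextCode_encodeState {W m c : ℕ} {z : ι → ℕ} {l : List ι}
    (h : ∃ p ∈ l, Blocked m c (z p) (s p)) :
    W ≤ nextCode B W m c z l (encodeState B s l) := by
  induction l with
  | nil => simp only [List.not_mem_nil, false_and, exists_false] at h
  | cons p l ih =>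
    rw [nextCode, encodeState_cons_div hs, encodeState_cons_mod hs, decodePair_encodePair (hs p).2]
    simp only [List.mem_cons, exists_eq_or_imp] at h
    rcases h with hp | hl
    · rw [nextDigit, if_pos hp]
      exact Nat.le_add_right _ _
    · exact (ih hl).trans (Nat.le_add_left _ _)

end Codes

/-! ### The dynamic program -/

section DynamicProgram

variable {V : Type*} (W : ℕ) (next : V → ℕ → ℕ) (w : V → ℤ)

/-- The best value obtained from a list of vertices to be processed, in the state with code `k`;
here `next v k` is the code after `v` is chosen, and `v` must not be chosen if this is at least
`W`. -/
def bestValue : List V → ℕ → ℤ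
  | [], _ => 0
  | v :: l, k =>
    if next v k < W ∧ bestValue l k < w v + bestValue l (next v k) then
      w v + bestValue l (next v k)
    else bestValue l k

/-- The test whether the vertex `v`, which is followed by the list `l`, is chosen. -/
def Takes (v : V) (l : List V) (k : ℕ) : Prop :=
  next v k < W ∧ bestValue W next w l k < w v + bestValue W next w l (next v k)

instance (v : V) (l : List V) (k : ℕ) : Decidable (Takes W next w v l k) :=
  inferInstanceAs (Decidable (_ ∧ _))

/-- The set of the chosen vertices. -/
def chosenSet [DecidableEq V] : List V → ℕ → Finset V
  | [], _ => ∅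
  | v :: l, k =>
    if Takes W next w v l k then insert v (chosenSet l (next v k)) else chosenSet l k

theorem bestValue_cons (v : V) (l : List V) (k : ℕ) :
    bestValue W next w (v :: l) k =
      if Takes W next w v l k then w v + bestValue W next w l (next v k)
      else bestValue W next w l k := rfl

theorem bestValue_le_cons (v : V) (l : List V) (k : ℕ) :
    bestValue W next w l k ≤ bestValue W next w (v :: l) k := by
  rw [bestValue_cons]
  split_ifs with h
  exacts [h.2.le, le_rfl]

variable {W next} in
theorem add_bestValue_le_cons {v : V} {l : List V} {k : ℕ} (h : next v k < W) :
    w v + bestValue W next w l (next v k) ≤ bestValue W next w (v :: l) k := by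
  rw [bestValue_cons]
  split_ifs with hk
  exacts [le_rfl, not_lt.1 fun hlt => hk ⟨h, hlt⟩]

variable [DecidableEq V]

theorem chosenSet_subset (l : List V) (k : ℕ) : chosenSet W next w l k ⊆ l.toFinset := by
  induction l generalizing k with
  | nil => exact Finset.Subset.refl _
  | cons v l ih =>
    rw [chosenSet, List.toFinset_cons]
    split_ifs
    · exact Finset.insert_subset_insert _ (ih _)
    · exact (ih _).trans (Finset.subset_insert _ _)

theorem sum_chosenSet {l : List V} (hl : l.Nodup) (k : ℕ) :
    ∑ v ∈ chosenSet W next w l k, w v = bestValue W next w l k := by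
  induction l generalizing k with
  | nil => rfl
  | cons v l ih =>
    rw [List.nodup_cons] at hl
    have hv : v ∉ chosenSet W next w l (next v k) := fun h =>
      hl.1 (List.mem_toFinset.1 (chosenSet_subset W next w _ _ h))
    rw [chosenSet, bestValue_cons]
    split_ifs
    · rw [Finset.sum_insert hv, ih hl.2]
    · exact ih hl.2 k

/-- The codes below `W` represent the sets `Y` with `Good Y`, as far as the addition of vertices in
the order `r` is concerned: `Represents Y k` says that `k` is a code of `Y`. -/
structure IsStateSpace (r : V → V → Prop) (Good : Finset V → Prop)
    (Represents : Finset V → ℕ → Prop) : Prop where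
  good : ∀ {Y k}, Represents Y k → Good Y
  represents_next : ∀ {Y v k}, Represents Y k → (∀ a ∈ Y, r a v) → Good (insert v Y) →
    next v k < W ∧ Represents (insert v Y) (next v k)
  le_next : ∀ {Y v k}, Represents Y k → (∀ a ∈ Y, r a v) → ¬ Good (insert v Y) → W ≤ next v k

namespace IsStateSpace

variable {W next} {r : V → V → Prop} {Good : Finset V → Prop} {Represents : Finset V → ℕ → Prop}
  (h : IsStateSpace W next r Good Represents) {l : List V} (hl : l.Pairwise r) {Y : Finset V}
  (hYl : ∀ b ∈ l, ∀ a ∈ Y, r a b) {k : ℕ} (hk : Represents Y k)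

include h hl hYl hk

theorem good_union_chosenSet : Good (Y ∪ chosenSet W next w l k) := by
  induction l generalizing Y k with
  | nil => simpa only [chosenSet, Finset.union_empty] using h.good hk
  | cons v l ih =>
    rw [List.pairwise_cons] at hl
    rw [List.forall_mem_cons] at hYl
    rw [chosenSet]
    split_ifs with htake
    · have hgood : Good (insert v Y) := by
        by_contra hbad
        exact htake.1.not_ge (h.le_next hk hYl.1 hbad)
      rw [Finset.union_insert, ← Finset.insert_union]
      exact ih hl.2 (fun b hb => Finset.forall_mem_insert _ _ _ |>.2 ⟨hl.1 b hb, hYl.2 b hb⟩)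
        (h.represents_next hk hYl.1 hgood).2
    · exact ih hl.2 hYl.2 hk

theorem sum_le_bestValue (hanti : ∀ {Y Z}, Y ⊆ Z → Good Z → Good Y) {Z : Finset V}
    (hZl : Z ⊆ l.toFinset) (hZ : Good (Y ∪ Z)) : ∑ v ∈ Z, w v ≤ bestValue W next w l k := by
  induction l generalizing Y k Z with
  | nil => rw [Finset.subset_empty.1 hZl, Finset.sum_empty, bestValue]
  | cons v l ih =>
    rw [List.pairwise_cons] at hl
    rw [List.forall_mem_cons] at hYl
    rw [List.toFinset_cons] at hZl
    by_cases hvZ : v ∈ Z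
    · have hgood : Good (insert v Y) := hanti
        (Finset.insert_subset (Finset.mem_union_right _ hvZ) Finset.subset_union_left) hZ
      obtain ⟨hlt, hk'⟩ := h.represents_next hk hYl.1 hgood
      rw [← Finset.add_sum_erase _ _ hvZ]
      refine le_trans (add_le_add_right (ih hl.2 (fun b hb => Finset.forall_mem_insert _ _ _ |>.2
        ⟨hl.1 b hb, hYl.2 b hb⟩) hk' (Finset.subset_insert_iff.1 hZl) ?_) _)
        (add_bestValue_le_cons w hlt)
      rwa [Finset.insert_union, ← Finset.union_insert, Finset.insert_erase hvZ]
    · exact (ih hl.2 hYl.2 hk ((Finset.subset_insert_iff_of_notMem hvZ).1 hZl) hZ).trans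
        (bestValue_le_cons W next w v l k)

end IsStateSpace

end DynamicProgram

/-! ### Correctness of the dynamic program -/

section Triangles

variable {V : Type*} {G : SimpleGraph V} {S Y Z : Finset V}

theorem NoTerminalTriangle.mono (h : NoTerminalTriangle G S Z) (hYZ : Y ⊆ Z) :
    NoTerminalTriangle G S Y :=
  fun a ha b hb c hc => h a (hYZ ha) b (hYZ hb) c (hYZ hc)

theorem noTerminalTriangle_insert_iff [DecidableEq V] (hY : NoTerminalTriangle G S Y) {v : V} :
    NoTerminalTriangle G S (insert v Y) ↔
      ∀ a ∈ Y, ∀ b ∈ Y, G.Adj a v → G.Adj b v → G.Adj a b → v ∉ S ∧ a ∉ S ∧ b ∉ S := by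
  constructor
  · intro h a ha b hb hav hbv hab
    have ha' := Finset.mem_insert_of_mem (b := v) ha
    have hb' := Finset.mem_insert_of_mem (b := v) hb
    have hv' := Finset.mem_insert_self v Y
    exact ⟨fun hS => h v hv' a ha' b hb' hS hav.symm hab hbv.symm,
      fun hS => h a ha' b hb' v hv' hS hab hbv hav,
      fun hS => h b hb' a ha' v hv' hS hab.symm hav hbv⟩
  · intro h a ha b hb c hc haS hab hbc hac
    rcases Finset.mem_insert.1 ha with rfl | haY
    · have hbY := Finset.mem_of_mem_insert_of_ne hb hab.ne'
      have hcY := Finset.mem_of_mem_insert_of_ne hc hac.ne'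
      exact (h b hbY c hcY hab.symm hac.symm hbc).1 haS
    · rcases Finset.mem_insert.1 hb with rfl | hbY
      · have hcY := Finset.mem_of_mem_insert_of_ne hc hbc.ne'
        exact (h a haY c hcY hab hbc.symm hac).2.1 haS
      · rcases Finset.mem_insert.1 hc with rfl | hcY
        · exact (h a haY b hbY hac hbc hab).2.1 haS
        · exact hY a haY b hbY c hcY haS hab hbc hac

end Triangles

namespace TreeModel

variable {n : ℕ} {G : SimpleGraph (Fin n)} {N : ℕ} {M : TreeModel G N} {S : Finset (Fin n)}

/-- The label of `v` for the tip `p`: the reach of the subtree of `v` towards `p`, and whether `v`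
is a terminal as the last binary digit. -/
noncomputable def label (M : TreeModel G N) (S : Finset (Fin n)) (v : Fin n) (p : Fin N) : ℕ :=
  if M.host.reach (M.sub v) p = 0 then 0
  else 2 * M.host.reach (M.sub v) p + if v ∈ S then 1 else 0

theorem label_lt (v : Fin n) (p : Fin N) : M.label S v p < 2 * N + 2 := by
  have := HostTree.reach_le (T := M.host) (M.sub v) p
  rw [label]
  split_ifs <;> omega

theorem lt_label_iff {v : Fin n} {p : Fin N} {m : ℕ} :
    2 * m + 1 < M.label S v p ↔ m < M.host.reach (M.sub v) p := by
  rw [label]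
  split_ifs <;> omega

theorem label_pos_iff {v : Fin n} {p : Fin N} :
    0 < M.label S v p ↔ 0 < M.host.reach (M.sub v) p := by
  rw [label]
  split_ifs <;> omega

theorem label_mod_two {v : Fin n} {p : Fin N} (h : 0 < M.label S v p) :
    M.label S v p % 2 = if v ∈ S then 1 else 0 := by
  rw [label] at h ⊢
  split_ifs at h ⊢ <;> omega

theorem adj_iff_lt_label {a v : Fin n} {p t : Fin N} (hav : a ≠ v)
    (ht : M.host.IsRootOf (M.sub v) t) (htd : M.host.depth t = M.level v)
    (hpt : M.host.Desc p t) (h : M.level a ≤ M.level v) :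
    G.Adj a v ↔ 2 * M.level v + 1 < M.label S a p := by
  rw [lt_label_iff, ← htd, ← (M.isSubtree a).mem_iff_lt_reach hpt (h.trans htd.ge)]
  exact ⟨fun hadj => isRootOf_mem_of_adj ht htd hadj h,
    fun hmem => (M.adj_iff a v hav).2 ⟨t, hmem, ht.1⟩⟩

section Blocked

variable {Y : Finset (Fin n)} {v : Fin n} {p t : Fin N} {s : ℕ × ℕ}
  (hv : ∀ a ∈ Y, a ≠ v ∧ M.level a ≤ M.level v)
  (ht : M.host.IsRootOf (M.sub v) t) (htd : M.host.depth t = M.level v) (hpt : M.host.Desc p t)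
  (hs : IsTopTwo Y (M.label S · p) s)

include hv ht htd hpt hs

theorem exists_neighbors_of_lt_snd (hlt : 2 * M.level v + 1 < s.2) :
    ∃ a ∈ Y, ∃ b ∈ Y, a ≠ b ∧ G.Adj a v ∧ G.Adj b v ∧
      s.1 % 2 = (if a ∈ S then 1 else 0) ∧ s.2 % 2 = if b ∈ S then 1 else 0 := by
  obtain ⟨a, ha, b, hb, hab, has, hbs⟩ := hs.snd_eq (by omega)
  have hle := hs.snd_le_fst
  refine ⟨a, ha, b, hb, hab, ?_, ?_, ?_, ?_⟩
  · exact (adj_iff_lt_label (hv a ha).1 ht htd hpt (hv a ha).2).2 (has ▸ hlt.trans_le hle)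
  · exact (adj_iff_lt_label (hv b hb).1 ht htd hpt (hv b hb).2).2 (hbs ▸ hlt)
  · rw [← has]
    exact label_mod_two (by omega)
  · rw [← hbs]
    exact label_mod_two (by omega)

theorem blocked_iff (hY : NoTerminalTriangle G S Y) :
    Blocked (2 * M.level v + 1) (if v ∈ S then 1 else 0) (M.label S v p) s ↔
      ¬ NoTerminalTriangle G S (insert v Y) := by
  have hchordal : ∀ a ∈ Y, ∀ b ∈ Y, a ≠ b → G.Adj a v → G.Adj b v → G.Adj a b :=
    fun a ha b hb hab hav hbv =>
      M.isPerfectElimination_level hab hav hbv (hv a ha).2 (hv b hb).2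
  rw [noTerminalTriangle_insert_iff hY]
  constructor
  · rintro ⟨-, hlt, hodd⟩ h
    obtain ⟨a, ha, b, hb, hab, hav, hbv, has, hbs⟩ :=
      exists_neighbors_of_lt_snd hv ht htd hpt hs hlt
    obtain ⟨hvS, haS, hbS⟩ := h a ha b hb hav hbv (hchordal a ha b hb hab hav hbv)
    rw [has, hbs, if_neg hvS, if_neg haS, if_neg hbS] at hodd
    exact hodd.false
  · intro h
    push Not at h
    obtain ⟨c, hc, d, hd, hcv, hdv, hcd, hS⟩ := h
    have hlt_label : ∀ a ∈ Y, G.Adj a v → 2 * M.level v + 1 < M.label S a p := fun a ha =>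
      (adj_iff_lt_label (hv a ha).1 ht htd hpt (hv a ha).2).1
    have hlt : 2 * M.level v + 1 < s.2 :=
      (lt_min (hlt_label c hc hcv) (hlt_label d hd hdv)).trans_le (hs.le_snd c hc d hd hcd.ne)
    have hpos : 0 < M.label S v p :=
      label_pos_iff.2 (HostTree.lt_reach_iff.2 ⟨t, ht.1, hpt, Nat.zero_le _⟩)
    refine ⟨hpos, hlt, ?_⟩
    obtain ⟨a, ha, b, hb, hab, hav, hbv, has, hbs⟩ :=
      exists_neighbors_of_lt_snd hv ht htd hpt hs hlt
    rw [has, hbs]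
    by_contra hnot
    have hvS : v ∉ S := fun hvS => hnot (by rw [if_pos hvS]; omega)
    have haS : a ∉ S := fun haS => hnot (by rw [if_pos haS]; omega)
    have hbS : b ∉ S := fun hbS => hnot (by rw [if_pos hbS]; omega)
    -- A terminal neighbour of `v` would form a terminal triangle with `a` and `b` within `Y`.
    have hnone : ∀ e ∈ Y, G.Adj e v → e ∉ S := fun e he hev heS =>
      hY e he a ha b hb heS (hchordal e he a ha (fun h => haS (h ▸ heS)) hev hav)
        (hchordal a ha b hb hab hav hbv) (hchordal e he b hb (fun h => hbS (h ▸ heS)) hev hbv)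
    exact hnone d hd hdv (hS hvS (hnone c hc hcv))

end Blocked

theorem exists_blocked_iff {Y : Finset (Fin n)} (hY : NoTerminalTriangle G S Y) {v : Fin n}
    (hv : ∀ a ∈ Y, a ≠ v ∧ M.level a ≤ M.level v) (hN : 1 < N) {tips : List (Fin N)}
    (htips : ∀ p, M.host.IsTip p → p ∈ tips) {s : Fin N → ℕ × ℕ}
    (hs : ∀ p, IsTopTwo Y (M.label S · p) (s p)) :
    (∃ p ∈ tips, Blocked (2 * M.level v + 1) (if v ∈ S then 1 else 0) (M.label S v p) (s p)) ↔
      ¬ NoTerminalTriangle G S (insert v Y) := by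
  obtain ⟨t, ht, htd⟩ := (M.isSubtree v).exists_isRootOf
  constructor
  · rintro ⟨p, -, hp⟩
    have hpt : M.host.Desc p t := ht.desc_of_reach_pos (label_pos_iff.1 hp.1)
    exact (blocked_iff hv ht htd hpt (hs p) hY).1 hp
  · intro h
    obtain ⟨p, hp, hpt⟩ := HostTree.exists_tip_desc hN t
    exact ⟨p, htips p hp, (blocked_iff hv ht htd hpt (hs p) hY).2 h⟩

/-- The code of the next state, if the vertex `v` is chosen. -/
noncomputable def next (M : TreeModel G N) (S : Finset (Fin n)) (tips : List (Fin N))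
    (v : Fin n) : ℕ → ℕ :=
  nextCode (2 * N + 2) (numCodes (2 * N + 2) tips.length) (2 * M.level v + 1)
    (if v ∈ S then 1 else 0) (M.label S v) tips

/-- The number `k` is the code of `Y`, a set without terminal triangles: it encodes the two largest
labels of `Y` for each tip. -/
def IsCodeOf (M : TreeModel G N) (S : Finset (Fin n)) (tips : List (Fin N)) (Y : Finset (Fin n))
    (k : ℕ) : Prop :=
  NoTerminalTriangle G S Y ∧ ∃ s : Fin N → ℕ × ℕ, (∀ p, IsTopTwo Y (M.label S · p) (s p)) ∧
    k = encodeState (2 * N + 2) s tips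

theorem isCodeOf_empty (tips : List (Fin N)) : M.IsCodeOf S tips ∅ 0 :=
  ⟨fun _ ha => absurd ha (Finset.notMem_empty _), fun _ => (0, 0), fun _ => IsTopTwo.empty _,
    (encodeState_zero tips).symm⟩

theorem isStateSpace (hN : 1 < N) {tips : List (Fin N)}
    (htips : ∀ p, M.host.IsTip p → p ∈ tips) :
    IsStateSpace (numCodes (2 * N + 2) tips.length) (M.next S tips)
      (fun a v => a ≠ v ∧ M.level a ≤ M.level v) (NoTerminalTriangle G S)
      (M.IsCodeOf S tips) := by
  have hbound : ∀ {Y} {s : Fin N → ℕ × ℕ}, (∀ p, IsTopTwo Y (M.label S · p) (s p)) →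
      ∀ p, (s p).1 < 2 * N + 2 ∧ (s p).2 < 2 * N + 2 :=
    fun hs p => (hs p).lt (Nat.succ_pos _) fun a _ => label_lt a p
  refine ⟨And.left, ?_, ?_⟩
  · rintro Y v _ ⟨hY, s, hs, rfl⟩ hv hgood
    have hs' : ∀ p, IsTopTwo (insert v Y) (M.label S · p) (insertLabel (M.label S v p) (s p)) :=
      fun p => (hs p).insert fun hvY => (hv v hvY).1 rfl
    have hnext : M.next S tips v (encodeState (2 * N + 2) s tips) =
        encodeState (2 * N + 2) (fun p => insertLabel (M.label S v p) (s p)) tips :=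
      nextCode_encodeState (hbound hs) fun p hp hb =>
        (exists_blocked_iff hY hv hN htips hs).1 ⟨p, hp, hb⟩ hgood
    rw [hnext]
    exact ⟨encodeState_lt (hbound hs') tips, hgood, _, hs', rfl⟩
  · rintro Y v _ ⟨hY, s, hs, rfl⟩ hv hbad
    exact le_nextCode_encodeState (hbound hs) ((exists_blocked_iff hY hv hN htips hs).2 hbad)

theorem isMinSubsetFVS_compl_chosenSet (hN : 1 < N) {tips : List (Fin N)}
    (htips : ∀ p, M.host.IsTip p → p ∈ tips) (w : Fin n → ℤ) {l : List (Fin n)} (hnd : l.Nodup)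
    (hsort : l.Pairwise fun a b => M.level a ≤ M.level b) (hl : ∀ v, v ∈ l) :
    IsMinSubsetFVS G S w
      (chosenSet (numCodes (2 * N + 2) tips.length) (M.next S tips) w l 0)ᶜ := by
  set Z := chosenSet (numCodes (2 * N + 2) tips.length) (M.next S tips) w l 0 with hZ
  have hspace := isStateSpace (M := M) (S := S) hN htips
  have hpair : l.Pairwise fun a v => a ≠ v ∧ M.level a ≤ M.level v := hnd.and hsort
  have hfvs := isSubsetFVS_iff M.isPerfectElimination_level S
  refine ⟨(hfvs _).2 ?_, fun X hX => ?_⟩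
  · rw [compl_compl, hZ, ← Finset.empty_union (chosenSet _ _ _ _ _)]
    exact hspace.good_union_chosenSet w hpair (by simp) (isCodeOf_empty tips)
  · have hle : ∑ v ∈ Xᶜ, w v ≤ ∑ v ∈ Z, w v := by
      rw [hZ, sum_chosenSet _ _ _ hnd]
      refine hspace.sum_le_bestValue w hpair (by simp) (isCodeOf_empty tips)
        (fun hYZ h => h.mono hYZ) (fun v _ => List.mem_toFinset.2 (hl v)) ?_
      rw [Finset.empty_union]
      exact (hfvs X).1 hX
    have hX := Finset.sum_add_sum_compl X w
    have hZ := Finset.sum_add_sum_compl Z w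
    omega

end TreeModel

/-! ### Registers and arrays of the program -/

namespace LeafageSFVS

open RAMProg

/-! The registers up to `rootReg` are constant once the input has been read, and those up to
`codesReg` once the preparations are over. -/

abbrev zeroReg : ℕ := 1
abbrev orderReg : ℕ := 2
abbrev nodesReg : ℕ := 3
abbrev rootReg : ℕ := 4
abbrev tipsReg : ℕ := 5
abbrev baseReg : ℕ := 6
abbrev squareReg : ℕ := 7
abbrev codesReg : ℕ := 8
abbrev layersReg : ℕ := 9
abbrev offsetReg : ℕ := 10

abbrev counterReg : ℕ := 11
abbrev innerReg : ℕ := 12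
abbrev nodeReg : ℕ := 13
abbrev depthReg : ℕ := 14
abbrev flagReg : ℕ := 15
abbrev addrReg : ℕ := 16
abbrev tempReg : ℕ := 17

abbrev sizesArr : ℕ := 0
abbrev terminalArr : ℕ := 2
abbrev weightArr : ℕ := 3
abbrev parentArr : ℕ := 4
abbrev memberArr : ℕ := 5
abbrev outputArr : ℕ := 6
abbrev depthArr : ℕ := 7
abbrev markArr : ℕ := 8
abbrev tipArr : ℕ := 9
abbrev parityArr : ℕ := 10
abbrev nextArr : ℕ := 11
abbrev valueArr : ℕ := 12
abbrev succArr : ℕ := 13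
abbrev rejectArr : ℕ := 14
abbrev vertexArr : ℕ := 15

/-- Copy register `a` to register `d`. -/
abbrev copy (d a : ℕ) : RAMProg := add d a zeroReg

/-! ### Reading the input -/

/-- Put `1`, `n`, `N` and the root into their registers. -/
def readInput : RAMProg := block [
  const oneReg 1, load orderReg sizesArr zeroReg, load nodesReg sizesArr oneReg,
  const counterReg 2, load rootReg sizesArr counterReg]

variable {n : ℕ} {G : SimpleGraph (Fin n)} {N : ℕ}

open Classical in
/-- The input is in the arrays and the sizes are in the registers. -/
structure Ready (M : TreeModel G N) (S : Finset (Fin n)) (w : Fin n → ℤ) (σ : RAMState) :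
    Prop where
  one : σ.reg oneReg = 1
  zero : σ.reg zeroReg = 0
  order : σ.reg orderReg = n
  nodes : σ.reg nodesReg = N
  root : σ.reg rootReg = (M.host.root : ℕ)
  terminal : ∀ v : Fin n, σ.arr terminalArr v = if v ∈ S then 1 else 0
  weight : ∀ v : Fin n, σ.arr weightArr v = w v
  parent : ∀ x : Fin N, σ.arr parentArr x = (M.host.parent x : ℕ)
  member : ∀ (v : Fin n) (x : Fin N), σ.arr memberArr (N * v + x) = if x ∈ M.sub v then 1 else 0

variable {M : TreeModel G N} {S : Finset (Fin n)} {w : Fin n → ℤ} {σ τ : RAMState}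

namespace Ready

theorem congr (h : Ready M S w σ) (hr : ∀ r < 5, τ.reg r = σ.reg r)
    (ha : ∀ a < 6, τ.arr a = σ.arr a) : Ready M S w τ where
  one := (hr _ (by decide)).trans h.one
  zero := (hr _ (by decide)).trans h.zero
  order := (hr _ (by decide)).trans h.order
  nodes := (hr _ (by decide)).trans h.nodes
  root := (hr _ (by decide)).trans h.root
  terminal := by rw [ha _ (by decide)]; exact h.terminal
  weight := by rw [ha _ (by decide)]; exact h.weight
  parent := by rw [ha _ (by decide)]; exact h.parent
  member := by rw [ha _ (by decide)]; exact h.member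

theorem setReg (h : Ready M S w σ) (d : ℕ) (z : ℤ) (hd : 5 ≤ d := by decide) :
    Ready M S w (σ.setReg d z) :=
  h.congr (fun r hr => by rw [RAMState.setReg_reg, if_neg (by omega)]) fun _ _ => rfl

theorem frame {p : RAMProg} (h : Ready M S w σ) (hF : Frame p σ τ)
    (hr : ∀ r < 5, r ∉ p.regs := by decide) (ha : ∀ a < 6, a ∉ p.arrs := by decide) :
    Ready M S w τ :=
  h.congr (fun r h' => hF.reg r (hr r h')) fun a h' => hF.arr a (ha a h')

end Ready

theorem mul_add_eq_mul_add_iff {v v' : ℕ} {x x' : Fin N} :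
    N * v + x = N * v' + x' ↔ v = v' ∧ x = x' := by
  refine ⟨fun h => ?_, by rintro ⟨rfl, rfl⟩; rfl⟩
  have hdiv := congrArg (· / N) h
  have hmod := congrArg (· % N) h
  simp only [Nat.mul_add_mod, Nat.mod_eq_of_lt x.2, Nat.mod_eq_of_lt x'.2] at hmod
  simp only [Nat.mul_add_div x.pos, Nat.div_eq_of_lt x.2, Nat.div_eq_of_lt x'.2] at hdiv
  exact ⟨hdiv, Fin.ext hmod⟩

open Classical in
theorem wp_readInput (M : TreeModel G N) (S : Finset (Fin n)) (w : Fin n → ℤ) :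
    wp readInput (inputState G S w M) fun τ t =>
      t ≤ 5 ∧ Ready M S w τ ∧ (∀ a, 6 ≤ a → ∀ i, τ.arr a i = 0) ∧
      τ.reg tipsReg = 0 ∧ τ.reg layersReg = 0 ∧ τ.reg offsetReg = 0 := by
  have hrest : ∀ a, 6 ≤ a → ∀ i, inputArr G S w M a i = 0 := fun a ha i => by
    obtain ⟨a, rfl⟩ := Nat.exists_eq_add_of_le' ha
    rfl
  simp only [readInput, wp_block_cons, wp_block_singleton, wp_const, wp_load]
  refine ⟨by decide, ⟨?_, ?_, ?_, ?_, ?_, fun v => ?_, fun v => ?_, fun x => ?_, fun v x => ?_⟩,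
    hrest, rfl, rfl, rfl⟩
  iterate 5 rfl
  · simp [inputState, inputArr, ← Fin.ext_iff]
  · simp [inputState, inputArr]
  · simp [inputState, inputArr]
  · have hcell : (∃ (v' : Fin n) (x' : Fin N), x' ∈ M.sub v' ∧ N * (v : ℕ) + x = N * v' + x') ↔
        x ∈ M.sub v := by
      simp only [mul_add_eq_mul_add_iff, ← Fin.ext_iff]
      aesop
    exact if_congr hcell rfl rfl

/-! ### Depths, tips and parities -/

/-- Put the depth of the node in `counterReg` into `depthReg`: from the node, follow `N` times the
pointer to the parent, and count the steps that do not start at the root. -/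
def measureDepth : RAMProg := block [
  copy nodeReg counterReg, const depthReg 0, copy innerReg nodesReg,
  forDown innerReg (block [
    sub flagReg nodeReg rootReg,
    .cond flagReg (add depthReg depthReg oneReg) (block [
      sub flagReg rootReg nodeReg, .cond flagReg (add depthReg depthReg oneReg) skip]),
    load nodeReg parentArr nodeReg])]

theorem wp_measureDepth (h : Ready M S w σ) {x : Fin N} (hx : σ.reg counterReg = (x : ℕ)) :
    wp measureDepth σ fun τ t => t ≤ N * 9 + 4 ∧ τ.reg depthReg = M.host.depth x := by
  simp only [measureDepth, wp_block_cons, wp_block_singleton, wp_add, wp_const]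
  refine wp_forDown N 7 (fun j τ => τ.reg nodeReg = (M.host.parent^[N - j] x : Fin N) ∧
      τ.reg depthReg = (min (N - j) (M.host.depth x) : ℕ))
    (by simp [h.nodes, h.zero]) (by simp [h.one]) (by simp [hx, h.zero]) ?_ ?_
  · rintro j hj τ hF ⟨hnode, hdepth⟩
    have hτ := (((h.setReg nodeReg _).setReg depthReg _).setReg innerReg _).frame hF
    obtain ⟨k, hk, hk'⟩ : ∃ k, N - j = k + 1 ∧ N - (j + 1) = k := ⟨_, by omega, rfl⟩
    have hroot : ((M.host.parent^[k] x : Fin N) : ℕ) = M.host.root ↔ M.host.depth x ≤ k :=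
      Fin.ext_iff.symm.trans M.host.iterate_eq_root_iff
    rw [hk'] at hnode hdepth
    rw [hk, Function.iterate_succ_apply']
    simp [hnode, hdepth, hτ.root, hτ.one, hτ.parent, -Fin.val_fin_lt]
    split_ifs <;> omega
  · rintro τ t - ⟨-, hdepth⟩ ht
    have := M.host.depth_lt x
    refine ⟨by omega, ?_⟩
    rw [hdepth]
    congr 1
    omega

theorem forall_le_iff {P : Fin N → Prop} {i : ℕ} (hi : i < N) :
    (∀ x : Fin N, i ≤ x → P x) ↔ P ⟨i, hi⟩ ∧ ∀ x : Fin N, i + 1 ≤ x → P x := by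
  refine ⟨fun h => ⟨h _ le_rfl, fun x hx => h x (by omega)⟩, fun ⟨hPi, h⟩ x hx => ?_⟩
  rcases hx.eq_or_lt with rfl | hlt
  exacts [hPi, h x hlt]

/-- Store the depths of the nodes. -/
def computeDepths : RAMProg := block [
  copy counterReg nodesReg,
  forDown counterReg (block [measureDepth, store depthArr counterReg depthReg])]

theorem wp_computeDepths (h : Ready M S w σ) :
    wp computeDepths σ fun τ t =>
      t ≤ N * (N * 9 + 5 + 2) + 2 ∧ ∀ x : Fin N, τ.arr depthArr x = M.host.depth x := by
  simp only [computeDepths, wp_block_cons, wp_block_singleton, wp_add]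
  refine wp_forDown N (N * 9 + 5)
    (fun i ρ => ∀ x : Fin N, i ≤ x → ρ.arr depthArr x = M.host.depth x)
    (by simp [h.nodes, h.zero]) (by simp [h.one]) (fun x hx => absurd x.2 (by omega)) ?_ ?_
  · intro i hi ρ hF hI
    have hρ := ((h.setReg counterReg _).frame hF).setReg counterReg i
    rw [wp_block_cons]
    refine wp_mono (wp_measureDepth hρ (x := ⟨i, hi⟩) (by simp)) fun τ t hF' ⟨_, hdepth⟩ => ?_
    have hcounter : τ.reg counterReg = i := hF'.reg _ (by decide)
    have harr : τ.arr depthArr = ρ.arr depthArr := hF'.arr _ (by decide)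
    rw [wp_block_singleton, wp_store, hcounter, hdepth]
    refine ⟨by omega, (forall_le_iff hi).2 ⟨by simp, fun x hx => ?_⟩⟩
    simpa [harr, (show (x : ℕ) ≠ i by omega)] using hI x hx
  · intro τ t _ hI ht
    exact ⟨by omega, fun x => hI x (Nat.zero_le _)⟩

/-- Mark the nodes that have children. -/
def markParents : RAMProg := block [
  copy counterReg nodesReg,
  forDown counterReg (block [load nodeReg parentArr counterReg, store markArr nodeReg oneReg])]

open Classical in
theorem wp_markParents (h : Ready M S w σ) (hmark : ∀ i, σ.arr markArr i = 0) :
    wp markParents σ fun τ t =>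
      t ≤ N * 4 + 2 ∧ ∀ x : Fin N, τ.arr markArr x = if M.host.IsTip x then 0 else 1 := by
  simp only [markParents, wp_block_cons, wp_block_singleton, wp_add]
  refine wp_forDown N 2
    (fun i ρ => ∀ x : Fin N,
      ρ.arr markArr x = if ∀ y : Fin N, i ≤ y → M.host.parent y ≠ x then 0 else 1)
    (by simp [h.nodes, h.zero]) (by simp [h.one]) (fun x => ?_) ?_ ?_
  · rw [if_pos fun y hy => absurd y.2 (by omega)]
    exact hmark x
  · intro i hi ρ hF hI
    have hρ := (h.setReg counterReg _).frame hF
    have hparent := hρ.parent ⟨i, hi⟩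
    suffices ∀ x : Fin N, (if x = M.host.parent ⟨i, hi⟩ then (1 : ℤ) else ρ.arr markArr x) =
        if ∀ y : Fin N, i ≤ y → M.host.parent y ≠ x then 0 else 1 by
      simpa [hparent, hρ.one, ← Fin.ext_iff] using this
    intro x
    simp only [hI x, forall_le_iff hi, ite_and, ite_not, eq_comm (a := x)]
  · intro τ t _ hI ht
    exact ⟨by omega, fun x => (hI x).trans (if_congr (by simp [HostTree.IsTip]) rfl rfl)⟩

/-- The list `l` of nodes is in the array `tipArr`, and its length is in `tipsReg`. -/
structure StoresTips (l : List (Fin N)) (σ : RAMState) : Prop where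
  length : σ.reg tipsReg = l.length
  getElem : ∀ (j : ℕ) (hj : j < l.length), σ.arr tipArr j = (l[j] : ℕ)

namespace StoresTips

variable {l : List (Fin N)}

theorem congr (h : StoresTips l σ) (hr : τ.reg tipsReg = σ.reg tipsReg)
    (ha : τ.arr tipArr = σ.arr tipArr) : StoresTips l τ :=
  ⟨hr.trans h.length, by rw [ha]; exact h.getElem⟩

end StoresTips

/-- Append the node in `counterReg` to the list of tips. -/
def appendTip : RAMProg := block [store tipArr tipsReg counterReg, add tipsReg tipsReg oneReg]

theorem wp_appendTip {l : List (Fin N)} {x : Fin N} (hl : StoresTips l σ)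
    (hone : σ.reg oneReg = 1) (hx : σ.reg counterReg = (x : ℕ)) :
    wp appendTip σ fun τ t => t = 2 ∧ StoresTips (l ++ [x]) τ := by
  simp only [appendTip, wp_block_cons, wp_block_singleton, wp_store, wp_add]
  refine ⟨trivial, by simp [hl.length, hone], fun j hj => ?_⟩
  rw [List.length_append, List.length_singleton, Nat.lt_succ_iff_lt_or_eq] at hj
  rcases hj with hj | rfl
  · simpa [hl.length, hj, hj.ne] using hl.getElem j hj
  · simp [hl.length, hx]

/-- List the tips. -/
def listTips : RAMProg := block [
  copy counterReg nodesReg,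
  forDown counterReg (block [load flagReg markArr counterReg, .cond flagReg skip appendTip])]

open Classical in
theorem wp_listTips (h : Ready M S w σ)
    (hmark : ∀ x : Fin N, σ.arr markArr x = if M.host.IsTip x then 0 else 1)
    (hlen : σ.reg tipsReg = 0) :
    wp listTips σ fun τ t => t ≤ N * 6 + 2 ∧
      ∃ tips : List (Fin N), tips.Nodup ∧ (∀ p, p ∈ tips ↔ M.host.IsTip p) ∧
        StoresTips tips τ := by
  simp only [listTips, wp_block_cons, wp_block_singleton, wp_add]
  refine wp_forDown N 4
    (fun i ρ => ∃ tips : List (Fin N), tips.Nodup ∧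
      (∀ p, p ∈ tips ↔ M.host.IsTip p ∧ i ≤ p) ∧ StoresTips tips ρ)
    (by simp [h.nodes, h.zero]) (by simp [h.one]) ⟨[], List.nodup_nil, by simp, by simpa, by simp⟩
    ?_ ?_
  · rintro i hi ρ hF ⟨tips, hnd, hmem, hstore⟩
    have hρ := (h.setReg counterReg _).frame hF
    have hmarkρ : ρ.arr markArr i = if M.host.IsTip ⟨i, hi⟩ then 0 else 1 := by
      rw [hF.arr _ (by decide)]
      exact hmark ⟨i, hi⟩
    have heq : ∀ p : Fin N, i ≤ p ↔ i + 1 ≤ p ∨ p = ⟨i, hi⟩ := fun p => by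
      rw [Fin.ext_iff]
      dsimp only
      omega
    simp only [wp_block_cons, wp_block_singleton, wp_load, wp_cond, wp_skip, RAMState.setReg_reg,
      RAMState.setReg_arr, if_true, Int.toNat_natCast, hmarkρ]
    by_cases htip : M.host.IsTip ⟨i, hi⟩
    · rw [if_pos htip, if_neg (lt_irrefl 0)]
      refine wp_mono (wp_appendTip (x := ⟨i, hi⟩) (hstore.congr (by simp) rfl) (by simp [hρ.one])
        (by simp)) fun τ t _ ⟨_, hstore'⟩ => ⟨by omega, _, ?_, fun p => ?_, hstore'⟩
      · simpa [List.nodup_append, hnd, hmem, Fin.ext_iff] using by omega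
      · grind
    · rw [if_neg htip, if_pos zero_lt_one]
      exact ⟨by omega, tips, hnd, by grind, hstore.congr (by simp) rfl⟩
  · rintro τ t - ⟨tips, hnd, hmem, hstore⟩ ht
    exact ⟨by omega, tips, hnd, by simpa using hmem, hstore⟩

/-- Put `2 * N + 2`, the base of the codes, and its square into their registers. -/
def computeBase : RAMProg := block [
  add baseReg nodesReg nodesReg, add baseReg baseReg oneReg, add baseReg baseReg oneReg,
  const squareReg 0, copy counterReg baseReg, addMul squareReg baseReg counterReg]

theorem wp_computeBase (h : Ready M S w σ) :
    wp computeBase σ fun τ t => t ≤ 6 * N + 12 ∧ τ.reg baseReg = (2 * N + 2 : ℕ) ∧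
      τ.reg squareReg = ((2 * N + 2) * (2 * N + 2) : ℕ) := by
  simp only [computeBase, wp_block_cons, wp_block_singleton, wp_add, wp_const]
  refine wp_addMul (2 * N + 2) (by simp [h.nodes, h.zero, h.one]; ring) (by simp [h.one])
    fun τ t hF hsquare ht => ?_
  have hbase : τ.reg baseReg = (2 * N + 2 : ℕ) := by
    rw [hF.reg _ (by decide)]
    suffices (N : ℤ) + N + 1 + 1 = 2 * N + 2 by simpa [h.nodes, h.one] using this
    ring
  refine ⟨by omega, hbase, ?_⟩
  rw [hsquare, ← hF.reg baseReg (by decide), hbase]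
  simp

/-- Multiply the contents of `codesReg` by the square of the base. -/
def multiplyCodes : RAMProg := block [
  copy tempReg codesReg, const codesReg 0, copy innerReg squareReg,
  addMul codesReg tempReg innerReg]

theorem wp_multiplyCodes (hone : σ.reg oneReg = 1) (hzero : σ.reg zeroReg = 0) {k c : ℕ}
    (hsquare : σ.reg squareReg = k) (hcodes : σ.reg codesReg = c) :
    wp multiplyCodes σ fun τ t => t ≤ 3 * k + 4 ∧ τ.reg codesReg = (k * c : ℕ) := by
  simp only [multiplyCodes, wp_block_cons, wp_block_singleton, wp_add, wp_const]
  refine wp_addMul k (by simp [hsquare, hzero]) (by simp [hone]) fun τ t _ hτ ht => ⟨by omega, ?_⟩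
  simp [hτ, hcodes, hzero]

/-- Put the number of codes into its register. -/
def computeCodes : RAMProg := block [
  const codesReg 1, copy counterReg tipsReg, forDown counterReg multiplyCodes]

theorem wp_computeCodes (hone : σ.reg oneReg = 1) (hzero : σ.reg zeroReg = 0) {r B : ℕ}
    (hr : σ.reg tipsReg = r) (hsquare : σ.reg squareReg = (B * B : ℕ)) :
    wp computeCodes σ fun τ t =>
      t ≤ r * (3 * (B * B) + 4 + 2) + 3 ∧ τ.reg codesReg = numCodes B r := by
  simp only [computeCodes, wp_block_cons, wp_block_singleton, wp_add, wp_const]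
  refine wp_forDown r (3 * (B * B) + 4) (fun i τ => τ.reg codesReg = numCodes B (r - i))
    (by simp [hr, hzero]) (by simp [hone]) (by simp [numCodes]) ?_ ?_
  · intro i hi τ hF hI
    refine wp_mono (wp_multiplyCodes (k := B * B) (c := numCodes B (r - (i + 1)))
      (by simp [hF.reg oneReg (by decide), hone]) (by simp [hF.reg zeroReg (by decide), hzero])
      (by simp [hF.reg squareReg (by decide), hsquare]) (by simp [hI])) fun ρ t _ ⟨ht, hρ⟩ => ?_
    rw [← numCodes_succ, show r - (i + 1) + 1 = r - i by omega] at hρ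
    exact ⟨ht, hρ⟩
  · intro τ t _ hI ht
    exact ⟨by omega, by simpa using hI⟩

/-- Store the parities of the numbers below `2 * N + 2`. -/
def computeParities : RAMProg := block [
  add counterReg nodesReg oneReg,
  forDown counterReg (block [
    add addrReg counterReg counterReg, add addrReg addrReg oneReg,
    store parityArr addrReg oneReg])]

theorem wp_computeParities (h : Ready M S w σ) (hparity : ∀ i, σ.arr parityArr i = 0) :
    wp computeParities σ fun τ t => t ≤ (N + 1) * 5 + 2 ∧
      ∀ d < 2 * N + 2, τ.arr parityArr d = (d % 2 : ℕ) := by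
  simp only [computeParities, wp_block_cons, wp_block_singleton, wp_add]
  refine wp_forDown (N + 1) 3
    (fun i ρ => ∀ d < 2 * N + 2, ρ.arr parityArr d = (if 2 * i ≤ d then d % 2 else 0 : ℕ))
    (by simp [h.nodes, h.one]) (by simp [h.one]) (fun d hd => ?_) ?_ ?_
  · rw [if_neg (by omega)]
    exact hparity d
  · intro i _ ρ hF hI
    have hρ := (h.setReg counterReg _).frame hF
    have haddr : ((i : ℤ) + i + 1).toNat = 2 * i + 1 := by omega
    suffices ∀ d < 2 * N + 2, (if d = 2 * i + 1 then (1 : ℤ) else ρ.arr parityArr d) =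
        (if 2 * i ≤ d then d % 2 else 0 : ℕ) by simpa [hρ.one, haddr] using this
    intro d hd
    rw [hI d hd]
    split_ifs <;> omega
  · intro τ t _ hI ht
    exact ⟨by omega, fun d hd => by simpa using hI d hd⟩

/-- The tables that do not depend on the vertex in turn have been computed. -/
structure Prepared (M : TreeModel G N) (S : Finset (Fin n)) (w : Fin n → ℤ)
    (tips : List (Fin N)) (σ : RAMState) : Prop extends Ready M S w σ, StoresTips tips σ where
  base : σ.reg baseReg = (2 * N + 2 : ℕ)
  codes : σ.reg codesReg = numCodes (2 * N + 2) tips.length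
  depth : ∀ x : Fin N, σ.arr depthArr x = M.host.depth x
  parity : ∀ d < 2 * N + 2, σ.arr parityArr d = (d % 2 : ℕ)

namespace Prepared

variable {tips : List (Fin N)}

theorem congr (h : Prepared M S w tips σ) (hr : ∀ r < 9, τ.reg r = σ.reg r)
    (ha : ∀ a < 11, a ≠ outputArr → τ.arr a = σ.arr a) : Prepared M S w tips τ where
  toReady := h.toReady.congr (fun r h' => hr r (by omega))
    fun a h' => ha a (by omega) (ne_of_lt h')
  toStoresTips := h.toStoresTips.congr (hr _ (by decide)) (ha _ (by decide) (by decide))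
  base := (hr _ (by decide)).trans h.base
  codes := (hr _ (by decide)).trans h.codes
  depth := by rw [ha _ (by decide) (by decide)]; exact h.depth
  parity := by rw [ha _ (by decide) (by decide)]; exact h.parity

theorem setReg (h : Prepared M S w tips σ) (d : ℕ) (z : ℤ) (hd : 9 ≤ d := by decide) :
    Prepared M S w tips (σ.setReg d z) :=
  h.congr (fun r hr => by rw [RAMState.setReg_reg, if_neg (by omega)]) fun _ _ _ => rfl

theorem frame {p : RAMProg} (h : Prepared M S w tips σ) (hF : Frame p σ τ)
    (hr : ∀ r < 9, r ∉ p.regs := by decide)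
    (ha : ∀ a < 11, a ≠ outputArr → a ∉ p.arrs := by decide) : Prepared M S w tips τ :=
  h.congr (fun r h' => hF.reg r (hr r h')) fun a h' h'' => hF.arr a (ha a h' h'')

end Prepared

/-- The tables of the host tree: depths, list of tips. -/
def prepareTree : RAMProg := block [computeDepths, markParents, listTips]

theorem wp_prepareTree (h : Ready M S w σ) (hmark : ∀ i, σ.arr markArr i = 0)
    (hlen : σ.reg tipsReg = 0) :
    wp prepareTree σ fun τ t => t ≤ N * (N * 9 + 17) + 6 ∧
      (∀ x : Fin N, τ.arr depthArr x = M.host.depth x) ∧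
      ∃ tips : List (Fin N), tips.Nodup ∧ (∀ p, p ∈ tips ↔ M.host.IsTip p) ∧
        StoresTips tips τ := by
  simp only [prepareTree, wp_block_cons, wp_block_singleton]
  refine wp_mono (wp_computeDepths h) fun σ₁ t₁ hF₁ ⟨_, hdepth⟩ => ?_
  have h₁ := h.frame hF₁
  refine wp_mono (wp_markParents h₁ (by rwa [hF₁.arr _ (by decide)])) fun σ₂ t₂ hF₂
    ⟨_, hmark₂⟩ => ?_
  have h₂ := h₁.frame hF₂
  refine wp_mono (wp_listTips h₂ hmark₂ (by
    rw [hF₂.reg _ (by decide), hF₁.reg _ (by decide), hlen])) fun σ₃ t₃ hF₃ ⟨_, htips⟩ => ?_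
  refine ⟨by nlinarith, ?_, htips⟩
  rw [hF₃.arr _ (by decide), hF₂.arr _ (by decide)]
  exact hdepth

/-- The sizes of the codes and the table of parities. -/
def prepareCodes : RAMProg := block [computeBase, computeCodes, computeParities]

theorem wp_prepareCodes (h : Ready M S w σ) {r : ℕ} (hr : σ.reg tipsReg = r)
    (hparity : ∀ i, σ.arr parityArr i = 0) :
    wp prepareCodes σ fun τ t =>
      t ≤ 11 * N + 22 + r * (3 * ((2 * N + 2) * (2 * N + 2)) + 4 + 2) ∧
      τ.reg baseReg = (2 * N + 2 : ℕ) ∧ τ.reg codesReg = numCodes (2 * N + 2) r ∧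
      ∀ d < 2 * N + 2, τ.arr parityArr d = (d % 2 : ℕ) := by
  simp only [prepareCodes, wp_block_cons, wp_block_singleton]
  refine wp_mono (wp_computeBase h) fun σ₁ t₁ hF₁ ⟨_, hbase, hsquare⟩ => ?_
  have h₁ := h.frame hF₁
  refine wp_mono (wp_computeCodes h₁.one h₁.zero ((hF₁.reg _ (by decide)).trans hr) hsquare)
    fun σ₂ t₂ hF₂ ⟨_, hcodes⟩ => ?_
  refine wp_mono (wp_computeParities (h₁.frame hF₂) (by
    rwa [hF₂.arr _ (by decide), hF₁.arr _ (by decide)])) fun σ₃ t₃ hF₃ ⟨_, hparity⟩ => ?_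
  exact ⟨by omega, by rw [hF₃.reg _ (by decide), hF₂.reg _ (by decide), hbase],
    by rw [hF₃.reg _ (by decide), hcodes], hparity⟩

/-- Everything that precedes the main loop. -/
def prepare : RAMProg := block [readInput, prepareTree, prepareCodes]

theorem wp_prepare (M : TreeModel G N) (S : Finset (Fin n)) (w : Fin n → ℤ) :
    wp prepare (inputState G S w M) fun τ t =>
      ∃ tips : List (Fin N), tips.Nodup ∧ (∀ p, p ∈ tips ↔ M.host.IsTip p) ∧
        Prepared M S w tips τ ∧ τ.reg layersReg = 0 ∧ τ.reg offsetReg = 0 ∧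
        (∀ i, τ.arr valueArr i = 0) ∧ t ≤ 100 * (tips.length + 1) * (N + 1) ^ 2 := by
  simp only [prepare, wp_block_cons, wp_block_singleton]
  refine wp_mono (wp_readInput M S w) fun σ₁ t₁ _ ⟨_, h₁, harr, hlen, hlayers, hoffset⟩ => ?_
  refine wp_mono (wp_prepareTree h₁ (harr _ (by decide)) hlen) fun σ₂ t₂ hF₂
    ⟨_, hdepth, tips, hnd, hmem, htips⟩ => ?_
  have h₂ := h₁.frame hF₂
  refine wp_mono (wp_prepareCodes h₂ htips.length (by
    rw [hF₂.arr _ (by decide)]; exact harr _ (by decide))) fun σ₃ t₃ hF₃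
    ⟨_, hbase, hcodes, hparity⟩ => ?_
  refine ⟨tips, hnd, hmem, ⟨h₂.frame hF₃, htips.congr (hF₃.reg _ (by decide))
    (hF₃.arr _ (by decide)), hbase, hcodes, ?_, hparity⟩, ?_, ?_, ?_, ?_⟩
  · rwa [hF₃.arr _ (by decide)]
  · rw [hF₃.reg _ (by decide), hF₂.reg _ (by decide), hlayers]
  · rw [hF₃.reg _ (by decide), hF₂.reg _ (by decide), hoffset]
  · rw [hF₃.arr _ (by decide), hF₂.arr _ (by decide)]
    exact harr _ (by decide)
  · nlinarith [Nat.zero_le (tips.length * N), Nat.zero_le (tips.length * N ^ 2)]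

end LeafageSFVS

/-! ### Levels and labels -/

namespace LeafageSFVS

open RAMProg

abbrev sweepReg : ℕ := 18
abbrev vertexReg : ℕ := 19
abbrev rowReg : ℕ := 20
abbrev terminalReg : ℕ := 21
abbrev thresholdReg : ℕ := 22
abbrev labelReg : ℕ := 23
abbrev blockLenReg : ℕ := 24
abbrev stepReg : ℕ := 25
abbrev levelReg : ℕ := 26
abbrev weightReg : ℕ := 27
abbrev tipIdxReg : ℕ := 28
abbrev reachReg : ℕ := 29

variable {n : ℕ} {G : SimpleGraph (Fin n)} {N : ℕ} {M : TreeModel G N} {S : Finset (Fin n)}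
  {w : Fin n → ℤ} {tips : List (Fin N)} {v : Fin n} {σ τ : RAMState}

/-- If the node in `counterReg` belongs to the subtree of the vertex in turn, lower `levelReg` to
its depth. -/
def lowerLevel : RAMProg := block [
  add addrReg rowReg counterReg, load flagReg memberArr addrReg,
  .cond flagReg (block [
    load depthReg depthArr counterReg, sub flagReg levelReg depthReg,
    .cond flagReg (copy levelReg depthReg) skip]) skip]

open Classical in
theorem wp_lowerLevel (h : Prepared M S w tips σ) (hrow : σ.reg rowReg = (N * v : ℕ)) {x : Fin N}
    (hx : σ.reg counterReg = (x : ℕ)) {c : ℕ} (hc : σ.reg levelReg = c) :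
    wp lowerLevel σ fun τ t => t ≤ 7 ∧
      τ.reg levelReg = (if x ∈ M.sub v then min c (M.host.depth x) else c : ℕ) := by
  have haddr : ((N : ℤ) * v + x).toNat = N * v + x := by
    rw [← Nat.cast_mul, ← Nat.cast_add, Int.toNat_natCast]
  by_cases hmem : x ∈ M.sub v <;>
    simp [lowerLevel, hrow, hx, hc, haddr, h.member, h.depth, h.zero, hmem]
  split_ifs <;> omega

/-- Put `N` times the vertex in `vertexReg` into `rowReg`, and the level of the vertex into
`levelReg`. -/
def computeLevel : RAMProg := block [
  const rowReg 0, copy innerReg vertexReg, addMul rowReg nodesReg innerReg,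
  copy levelReg nodesReg, copy counterReg nodesReg, forDown counterReg lowerLevel]

theorem eq_level_of_forall_le_iff {c : ℕ}
    (hc : ∀ m, m ≤ c ↔ m ≤ N ∧ ∀ x ∈ M.sub v, m ≤ M.host.depth x) : c = M.level v := by
  obtain ⟨x, hx, hxd⟩ := Nat.sInf_mem ((M.isSubtree v).nonempty.image M.host.depth)
  refine le_antisymm ((((hc c).1 le_rfl).2 x hx).trans hxd.le) ((hc _).2 ⟨?_, fun y hy => ?_⟩)
  · exact hxd.ge.trans (M.host.depth_lt x).le
  · exact HostTree.minDepth_le hy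

open Classical in
theorem wp_computeLevel (h : Prepared M S w tips σ) (hv : σ.reg vertexReg = (v : ℕ)) :
    wp computeLevel σ fun τ t => t ≤ 3 * n + (N * (7 + 2) + 6) ∧
      τ.reg rowReg = (N * v : ℕ) ∧ τ.reg levelReg = M.level v := by
  simp only [computeLevel, wp_block_cons, wp_block_singleton, wp_add, wp_const]
  refine wp_addMul v (by simp [hv, h.zero]) (by simp [h.one]) fun ρ t hF hrow _ => ?_
  have hρ := ((h.setReg rowReg _).setReg innerReg _).frame hF
  have hrowρ : ρ.reg rowReg = (N * v : ℕ) := by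
    suffices (v : ℤ) * N = N * v by simpa [h.nodes, hrow] using this
    exact mul_comm _ _
  refine wp_forDown N 7
    (fun i τ => ∃ c : ℕ, τ.reg levelReg = c ∧
      ∀ m, m ≤ c ↔ m ≤ N ∧ ∀ x : Fin N, i ≤ x → x ∈ M.sub v → m ≤ M.host.depth x)
    (by simp [hρ.nodes, hρ.zero]) (by simp [hρ.one])
    ⟨N, by simp [hρ.nodes, hρ.zero], fun m => ?_⟩ ?_ ?_
  · exact (and_iff_left fun x hx => absurd x.2 (by omega)).symm
  · rintro i hi τ hF' ⟨c, hc, hle⟩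
    have hτ := (((hρ.setReg levelReg _).setReg counterReg _).frame hF').setReg counterReg i
    refine wp_mono (wp_lowerLevel (v := v) (x := ⟨i, hi⟩) (c := c) hτ
      (by simp [hF'.reg rowReg (by decide), hrowρ]) (by simp) (by simp [hc]))
      fun τ' t' _ ⟨ht', hlevel⟩ => ⟨ht', _, hlevel, fun m => ?_⟩
    rw [forall_le_iff hi, and_left_comm, ← hle]
    split_ifs with hx <;> simp [hx, and_comm]
  · rintro τ t' hF' ⟨c, hc, hle⟩ ht'
    have := v.2
    refine ⟨by omega, ?_, ?_⟩
    · simp [hF'.reg rowReg (by decide), hrowρ]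
    · rw [hc, eq_level_of_forall_le_iff (c := c) (by simpa using hle)]

open Classical in
/-- The data of the vertex `v` in turn are in their registers. -/
structure AtVertex (M : TreeModel G N) (S : Finset (Fin n)) (w : Fin n → ℤ)
    (tips : List (Fin N)) (v : Fin n) (σ : RAMState) : Prop extends Prepared M S w tips σ where
  row : σ.reg rowReg = (N * v : ℕ)
  terminal_reg : σ.reg terminalReg = if v ∈ S then 1 else 0
  threshold : σ.reg thresholdReg = (2 * M.level v + 1 : ℕ)

namespace AtVertex

theorem congr (h : AtVertex M S w tips v σ) (hr : ∀ r < 23, r < 9 ∨ 20 ≤ r → τ.reg r = σ.reg r)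
    (ha : ∀ a < 11, a ≠ outputArr → τ.arr a = σ.arr a) : AtVertex M S w tips v τ where
  toPrepared := h.toPrepared.congr (fun r h' => hr r (by omega) (.inl h')) ha
  row := (hr _ (by decide) (by decide)).trans h.row
  terminal_reg := (hr _ (by decide) (by decide)).trans h.terminal_reg
  threshold := (hr _ (by decide) (by decide)).trans h.threshold

theorem setReg (h : AtVertex M S w tips v σ) (d : ℕ) (z : ℤ)
    (hd : 9 ≤ d ∧ (d < 20 ∨ 23 ≤ d) := by decide) : AtVertex M S w tips v (σ.setReg d z) :=
  h.congr (fun r hr hr' => by rw [RAMState.setReg_reg, if_neg (by omega)]) fun _ _ _ => rfl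

theorem frame {p : RAMProg} (h : AtVertex M S w tips v σ) (hF : Frame p σ τ)
    (hr : ∀ r < 23, r < 9 ∨ 20 ≤ r → r ∉ p.regs := by decide)
    (ha : ∀ a < 11, a ≠ outputArr → a ∉ p.arrs := by decide) : AtVertex M S w tips v τ :=
  h.congr (fun r h' h'' => hF.reg r (hr r h' h'')) fun a h' h'' => hF.arr a (ha a h' h'')

end AtVertex

/-- If the node in `nodeReg` belongs to the subtree of the vertex in turn, raise `reachReg` above
its depth. Then go to the parent of the node. -/
def raiseReach : RAMProg := block [
  add addrReg rowReg nodeReg, load flagReg memberArr addrReg,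
  .cond flagReg (block [
    load depthReg depthArr nodeReg, add depthReg depthReg oneReg, sub flagReg depthReg reachReg,
    .cond flagReg (copy reachReg depthReg) skip]) skip,
  load nodeReg parentArr nodeReg]

open Classical in
theorem wp_raiseReach (h : AtVertex M S w tips v σ) {x : Fin N}
    (hx : σ.reg nodeReg = (x : ℕ)) {c : ℕ} (hc : σ.reg reachReg = c) :
    wp raiseReach σ fun τ t => t ≤ 9 ∧ τ.reg nodeReg = (M.host.parent x : ℕ) ∧
      τ.reg reachReg = (max (if x ∈ M.sub v then M.host.depth x + 1 else 0) c : ℕ) := by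
  have haddr : ((N : ℤ) * v + x).toNat = N * v + x := by
    rw [← Nat.cast_mul, ← Nat.cast_add, Int.toNat_natCast]
  simp [raiseReach, h.row, hx, hc, haddr, h.member, h.depth, h.parent, h.one, h.zero]
  split_ifs <;> omega

/-- Put the reach of the vertex in turn towards the tip in turn into `reachReg`. -/
def computeReach : RAMProg := block [
  load nodeReg tipArr tipIdxReg, const reachReg 0, copy innerReg nodesReg,
  forDown innerReg raiseReach]

theorem wp_computeReach (h : AtVertex M S w tips v σ) {j : ℕ} (hj : j < tips.length)
    (htip : σ.reg tipIdxReg = j) :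
    wp computeReach σ fun τ t => t ≤ N * (9 + 2) + 4 ∧
      τ.reg reachReg = M.host.reach (M.sub v) tips[j] := by
  classical
  simp only [computeReach, wp_block_cons, wp_block_singleton, wp_add, wp_load, wp_const]
  refine wp_forDown N 9
    (fun i τ => τ.reg nodeReg = (M.host.parent^[N - i] tips[j] : Fin N) ∧
      τ.reg reachReg = ((Finset.range (N - i)).sup fun k =>
        if M.host.parent^[k] tips[j] ∈ M.sub v then M.host.depth (M.host.parent^[k] tips[j]) + 1
        else 0 : ℕ))
    (by simp [h.nodes, h.zero]) (by simp [h.one]) (by simp [htip, h.getElem j hj]) ?_ ?_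
  · rintro i hi τ hF ⟨hnode, hreach⟩
    have hτ := ((((h.setReg nodeReg _).setReg reachReg _).setReg innerReg _).frame hF).setReg
      innerReg i
    rw [show N - i = N - (i + 1) + 1 by omega, Function.iterate_succ_apply',
      Finset.range_add_one, Finset.sup_insert]
    exact wp_mono (wp_raiseReach hτ (by simp [hnode]) (by simp [hreach])) fun _ _ _ h => h
  · rintro τ t _ ⟨-, hreach⟩ ht
    exact ⟨by omega, by simpa [HostTree.reach] using hreach⟩

/-- Put the label of the vertex in turn for the tip in turn into `labelReg`. -/
def computeLabel : RAMProg := block [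
  computeReach, add labelReg reachReg reachReg,
  .cond reachReg (add labelReg labelReg terminalReg) skip]

theorem wp_computeLabel (h : AtVertex M S w tips v σ) {j : ℕ} (hj : j < tips.length)
    (htip : σ.reg tipIdxReg = j) :
    wp computeLabel σ fun τ t => t ≤ N * (9 + 2) + 7 ∧ τ.reg labelReg = M.label S v tips[j] := by
  simp only [computeLabel, wp_block_cons, wp_block_singleton]
  refine wp_mono (wp_computeReach h hj htip) fun τ t hF ⟨_, hreach⟩ => ?_
  have hτ := h.frame hF
  simp [hreach, hτ.terminal_reg, TreeModel.label]
  split_ifs <;> omega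

end LeafageSFVS

/-! ### The table of next codes -/

namespace LeafageSFVS

open RAMProg

abbrev tableReg : ℕ := 30
abbrev tableLenReg : ℕ := 31
abbrev fstReg : ℕ := 32
abbrev sndReg : ℕ := 33
abbrev newFstReg : ℕ := 34
abbrev newSndReg : ℕ := 35
abbrev blockedReg : ℕ := 36
abbrev digitReg : ℕ := 37

variable {n : ℕ} {G : SimpleGraph (Fin n)} {N : ℕ} {M : TreeModel G N} {S : Finset (Fin n)}
  {w : Fin n → ℤ} {tips : List (Fin N)} {v : Fin n} {p : Fin N} {L : ℕ} {σ τ : RAMState}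

/-- The data of the vertex `v` and the tip `p` in turn are in their registers, and so is the number
`L` of codes for the tips that have been dealt with. -/
structure AtTip (M : TreeModel G N) (S : Finset (Fin n)) (w : Fin n → ℤ) (tips : List (Fin N))
    (v : Fin n) (p : Fin N) (L : ℕ) (σ : RAMState) : Prop extends AtVertex M S w tips v σ where
  label : σ.reg labelReg = M.label S v p
  blockLen : σ.reg blockLenReg = L
  step : σ.reg stepReg = ((2 * N + 2) * L : ℕ)

namespace AtTip

theorem congr (h : AtTip M S w tips v p L σ) (hr : ∀ r < 26, r < 9 ∨ 20 ≤ r → τ.reg r = σ.reg r)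
    (ha : ∀ a < 11, a ≠ outputArr → τ.arr a = σ.arr a) : AtTip M S w tips v p L τ where
  toAtVertex := h.toAtVertex.congr (fun r h' => hr r (by omega)) ha
  label := (hr _ (by decide) (by decide)).trans h.label
  blockLen := (hr _ (by decide) (by decide)).trans h.blockLen
  step := (hr _ (by decide) (by decide)).trans h.step

theorem setReg (h : AtTip M S w tips v p L σ) (d : ℕ) (z : ℤ)
    (hd : 9 ≤ d ∧ (d < 20 ∨ 26 ≤ d) := by decide) : AtTip M S w tips v p L (σ.setReg d z) :=
  h.congr (fun r hr hr' => by rw [RAMState.setReg_reg, if_neg (by omega)]) fun _ _ _ => rfl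

theorem frame {p' : RAMProg} (h : AtTip M S w tips v p L σ) (hF : Frame p' σ τ)
    (hr : ∀ r < 26, r < 9 ∨ 20 ≤ r → r ∉ p'.regs := by decide)
    (ha : ∀ a < 11, a ≠ outputArr → a ∉ p'.arrs := by decide) : AtTip M S w tips v p L τ :=
  h.congr (fun r h' h'' => hF.reg r (hr r h' h'')) fun a h' h'' => hF.arr a (ha a h' h'')

end AtTip

/-- Insert the label in turn into the pair in turn. -/
def insertPair : RAMProg := block [
  sub flagReg fstReg labelReg,
  .cond flagReg (block [copy newFstReg fstReg, copy tempReg labelReg])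
    (block [copy newFstReg labelReg, copy tempReg fstReg]),
  sub flagReg sndReg tempReg,
  .cond flagReg (copy newSndReg sndReg) (copy newSndReg tempReg)]

theorem wp_insertPair (hzero : σ.reg zeroReg = 0) {d e z : ℕ} (hd : σ.reg fstReg = d)
    (he : σ.reg sndReg = e) (hz : σ.reg labelReg = z) :
    wp insertPair σ fun τ t => t ≤ 7 ∧ τ.reg newFstReg = ((insertLabel z (d, e)).1 : ℕ) ∧
      τ.reg newSndReg = ((insertLabel z (d, e)).2 : ℕ) := by
  simp [insertPair, hd, he, hz, hzero, insertLabel]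
  split_ifs <;> omega

/-- Make `blockedReg` positive if and only if the insertion is blocked. -/
def testBlocked : RAMProg := block [
  const blockedReg 0,
  .cond labelReg (block [
    sub flagReg sndReg thresholdReg,
    .cond flagReg (block [
      load blockedReg parityArr fstReg, load tempReg parityArr sndReg,
      add blockedReg blockedReg tempReg, add blockedReg blockedReg terminalReg]) skip]) skip]

theorem wp_testBlocked {d e z m c : ℕ} (hd : σ.reg fstReg = d) (he : σ.reg sndReg = e)
    (hz : σ.reg labelReg = z) (hm : σ.reg thresholdReg = m) (hc : σ.reg terminalReg = c)
    (hpd : σ.arr parityArr d = (d % 2 : ℕ)) (hpe : σ.arr parityArr e = (e % 2 : ℕ)) :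
    wp testBlocked σ fun τ t => t ≤ 8 ∧ (0 < τ.reg blockedReg ↔ Blocked m c z (d, e)) := by
  simp [testBlocked, hd, he, hz, hm, hc, hpd, hpe, Blocked]
  split_ifs <;> omega

/-- The contribution of the pair for the tip `p` to the code of the next state, if the vertex `v` is
chosen; see `nextDigit`. -/
noncomputable def digit (M : TreeModel G N) (S : Finset (Fin n)) (tips : List (Fin N)) (v : Fin n)
    (p : Fin N) (L : ℕ) (s : ℕ × ℕ) : ℕ :=
  nextDigit (2 * N + 2) (numCodes (2 * N + 2) tips.length) (2 * M.level v + 1)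
    (if v ∈ S then 1 else 0) (M.label S v p) L s

/-- Put the contribution of the pair in turn to the next code into `digitReg`. -/
def computeDigit : RAMProg := block [
  insertPair, testBlocked,
  .cond blockedReg (copy digitReg codesReg) (block [
    const digitReg 0, addMul digitReg stepReg newFstReg, addMul digitReg blockLenReg newSndReg])]

theorem wp_computeDigit (h : AtTip M S w tips v p L σ) {d e : ℕ} (hd : σ.reg fstReg = d)
    (he : σ.reg sndReg = e) (hdB : d < 2 * N + 2) (heB : e < 2 * N + 2) :
    wp computeDigit σ fun τ t => t ≤ 6 * (2 * N + 2) + 20 ∧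
      τ.reg digitReg = digit M S tips v p L (d, e) := by
  simp only [computeDigit, wp_block_cons, wp_block_singleton]
  refine wp_mono (wp_insertPair h.zero hd he h.label) fun ρ₁ t₁ hF₁ ⟨_, hfst, hsnd⟩ => ?_
  have h₁ := h.frame hF₁
  refine wp_mono (wp_testBlocked (by rw [hF₁.reg _ (by decide), hd])
    (by rw [hF₁.reg _ (by decide), he]) h₁.label h₁.threshold (c := if v ∈ S then 1 else 0)
    (by by_cases hv : v ∈ S <;> simp [h₁.terminal_reg, hv]) (h₁.parity d hdB) (h₁.parity e heB))
    fun ρ₂ t₂ hF₂ ⟨_, hblocked⟩ => ?_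
  have h₂ := h₁.frame hF₂
  have hfst₂ := (hF₂.reg newFstReg (by decide)).trans hfst
  have hsnd₂ := (hF₂.reg newSndReg (by decide)).trans hsnd
  have hlt := insertLabel_lt (s := (d, e)) (M.label_lt (S := S) v p) ⟨hdB, heB⟩
  simp only [wp_cond, digit, nextDigit, ← hblocked]
  by_cases hpos : 0 < ρ₂.reg blockedReg
  · simp only [if_pos hpos]
    suffices t₁ + (t₂ + 2) ≤ 6 * (2 * N + 2) + 20 by simpa [h₂.codes, h₂.zero] using this
    omega
  simp only [if_neg hpos, wp_block_cons, wp_block_singleton, wp_const]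
  refine wp_addMul _ (by simpa using hfst₂) (by simp [h₂.one]) fun ρ₃ t₃ hF₃ hdigit₃ ht₃ => ?_
  have h₃ := (h₂.setReg digitReg 0).frame hF₃
  have hsnd₃ := (hF₃.reg newSndReg (by decide)).trans ((RAMState.setReg_reg ..).trans hsnd₂)
  refine wp_addMul _ hsnd₃ h₃.one fun ρ₄ t₄ _ hdigit₄ ht₄ => ⟨by omega, ?_⟩
  rw [hdigit₄, hdigit₃]
  simp [h₂.step, h₃.blockLen, encodePair]
  ring

/-- The entries from `off` on are the new ones, and the old ones below `off` are still there. -/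
structure IsExtending (K L : ℕ) (new old : ℕ → ℕ) (off : ℕ) (a : ℕ → ℤ) : Prop where
  new : ∀ k < K, off ≤ k → a k = new k
  old : ∀ k < L, k < off → a k = old k

/-- Fill the part of the table of next codes that belongs to the pair in turn. -/
def fillBlock : RAMProg := block [
  copy counterReg blockLenReg,
  forDown counterReg (block [
    load tempReg nextArr counterReg, add tempReg tempReg digitReg,
    add addrReg tableReg counterReg, store nextArr addrReg tempReg])]

theorem wp_fillBlock (hone : σ.reg oneReg = 1) (hzero : σ.reg zeroReg = 0)
    (hL : σ.reg blockLenReg = L) {off b K : ℕ} (hoff : σ.reg tableReg = off)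
    (hb : σ.reg digitReg = b) {new old : ℕ → ℕ} (hnew : ∀ k < L, new (off + k) = b + old k)
    (hI : IsExtending K L new old (off + L) (σ.arr nextArr)) :
    wp fillBlock σ fun τ t =>
      t ≤ L * (4 + 2) + 2 ∧ IsExtending K L new old off (τ.arr nextArr) := by
  simp only [fillBlock, wp_block_cons, wp_block_singleton, wp_add]
  refine wp_forDown L 4 (fun i ρ => IsExtending K L new old (off + i) (ρ.arr nextArr))
    (by simp [hL, hzero]) (by simp [hone]) hI ?_ ?_
  · intro i hi ρ hF hρ
    have haddr : ((off : ℤ) + i).toNat = off + i := by omega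
    have hread := hρ.old i hi (by omega)
    have htable : ρ.reg tableReg = off := by simp [hF.reg tableReg (by decide), hoff]
    have hdigit : ρ.reg digitReg = b := by simp [hF.reg digitReg (by decide), hb]
    simp only [wp_block_cons, wp_block_singleton, wp_load, wp_add, wp_store]
    refine ⟨le_rfl, fun k hk hik => ?_, fun k hk hki => ?_⟩
    · by_cases hki : k = off + i
      · simp [htable, hdigit, haddr, hread, hki, hnew i hi, add_comm]
      · simpa [htable, haddr, hki] using hρ.new k hk (by omega)
    · simpa [htable, haddr, show k ≠ off + i by omega] using hρ.old k hk (by omega)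
  · intro τ t _ hτ ht
    exact ⟨by omega, hτ⟩

/-- The table of next codes is extended by the tip `p`, from the last pair down to the pair with
the code `q`. -/
def TableInv (M : TreeModel G N) (S : Finset (Fin n)) (tips : List (Fin N)) (v : Fin n) (p : Fin N)
    (L : ℕ) (old : ℕ → ℕ) (q : ℕ) (σ : RAMState) : Prop :=
  σ.reg tableReg = (q * L : ℕ) ∧
  IsExtending ((2 * N + 2) * (2 * N + 2) * L) L
    (fun k => digit M S tips v p L (decodePair (2 * N + 2) (k / L)) + old (k % L)) old (q * L)
    (σ.arr nextArr)

/-- Extend the table by the pair in turn. -/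
def extendPair : RAMProg := block [sub tableReg tableReg blockLenReg, computeDigit, fillBlock]

theorem wp_extendPair (h : AtTip M S w tips v p L σ) {d e : ℕ} (hd : σ.reg fstReg = d)
    (he : σ.reg sndReg = e) (hdB : d < 2 * N + 2) (heB : e < 2 * N + 2) {old : ℕ → ℕ}
    (hI : TableInv M S tips v p L old (d * (2 * N + 2) + (e + 1)) σ) :
    wp extendPair σ fun τ t => t ≤ 6 * (2 * N + 2) + 6 * L + 23 ∧
      TableInv M S tips v p L old (d * (2 * N + 2) + e) τ := by
  obtain ⟨htable, hext⟩ := hI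
  have hsucc : (d * (2 * N + 2) + (e + 1)) * L = (d * (2 * N + 2) + e) * L + L := by ring
  rw [hsucc] at htable hext
  simp only [extendPair, wp_block_cons, wp_block_singleton, wp_sub, h.blockLen, htable,
    Nat.cast_add, add_sub_cancel_right]
  refine wp_mono (wp_computeDigit (h.setReg tableReg _) hd he hdB heB)
    fun ρ t hF ⟨_, hdigit⟩ => ?_
  have hρ := (h.setReg tableReg _).frame hF
  have htableρ : ρ.reg tableReg = ((d * (2 * N + 2) + e) * L : ℕ) := hF.reg _ (by decide)
  have harr : ρ.arr nextArr = σ.arr nextArr := hF.arr _ (by decide)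
  refine wp_mono (wp_fillBlock hρ.one hρ.zero hρ.blockLen htableρ hdigit (fun k hk => ?_)
    (harr ▸ hext)) fun τ t' hF' ⟨_, hτ⟩ => ⟨by omega, ?_, hτ⟩
  · have hpair := decodePair_encodePair (s := (d, e)) heB
    rw [encodePair] at hpair
    rw [mul_add_div_of_lt hk, Nat.mul_add_mod_of_lt hk, hpair]
  · rw [hF'.reg _ (by decide), htableρ]

/-- Extend the table by all pairs with a given first number. -/
def extendRow : RAMProg := block [copy sndReg baseReg, forDown sndReg extendPair]

theorem wp_extendRow (h : AtTip M S w tips v p L σ) {d : ℕ} (hd : σ.reg fstReg = d)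
    (hdB : d < 2 * N + 2) {old : ℕ → ℕ}
    (hI : TableInv M S tips v p L old ((d + 1) * (2 * N + 2)) σ) :
    wp extendRow σ fun τ t => t ≤ (2 * N + 2) * (6 * (2 * N + 2) + 6 * L + 23 + 2) + 2 ∧
      TableInv M S tips v p L old (d * (2 * N + 2)) τ := by
  simp only [extendRow, wp_block_cons, wp_block_singleton, wp_add]
  refine wp_forDown (2 * N + 2) (6 * (2 * N + 2) + 6 * L + 23)
    (fun e ρ => TableInv M S tips v p L old (d * (2 * N + 2) + e) ρ)
    (by simp [h.base, h.zero]) (by simp [h.one]) (Nat.succ_mul d _ ▸ hI) ?_ ?_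
  · intro e he ρ hF hρ
    exact wp_extendPair (((h.setReg sndReg _).frame hF).setReg sndReg e)
      (by simp [hF.reg fstReg (by decide), hd]) (by simp) hdB he hρ
  · intro τ t _ hτ ht
    exact ⟨by omega, hτ⟩

/-- Extend the table by all pairs for the tip in turn. -/
def extendTable : RAMProg := block [copy fstReg baseReg, forDown fstReg extendRow]

theorem wp_extendTable (h : AtTip M S w tips v p L σ) {old : ℕ → ℕ}
    (htable : σ.reg tableReg = ((2 * N + 2) * (2 * N + 2) * L : ℕ))
    (hold : ∀ k < L, σ.arr nextArr k = old k) :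
    wp extendTable σ fun τ t =>
      t ≤ (2 * N + 2) * ((2 * N + 2) * (6 * (2 * N + 2) + 6 * L + 23 + 2) + 2 + 2) + 2 ∧
      ∀ k < (2 * N + 2) * (2 * N + 2) * L, τ.arr nextArr k =
        (digit M S tips v p L (decodePair (2 * N + 2) (k / L)) + old (k % L) : ℕ) := by
  simp only [extendTable, wp_block_cons, wp_block_singleton, wp_add]
  refine wp_forDown (2 * N + 2) ((2 * N + 2) * (6 * (2 * N + 2) + 6 * L + 23 + 2) + 2)
    (fun d ρ => TableInv M S tips v p L old (d * (2 * N + 2)) ρ)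
    (by simp [h.base, h.zero]) (by simp [h.one]) ⟨htable, ?_⟩ ?_ ?_
  · exact ⟨fun k hk hk' => absurd hk (not_lt.2 hk'), fun k hk _ => hold k hk⟩
  · intro d hd ρ hF hρ
    exact wp_extendRow (((h.setReg fstReg _).frame hF).setReg fstReg d) (by simp) hd hρ
  · rintro τ t _ ⟨-, hτ⟩ ht
    exact ⟨by omega, fun k hk => hτ.new k hk (by simp)⟩

/-- Put the multiples of the number of old entries by the base and by its square into their
registers. -/
def computeSizes : RAMProg := block [
  const stepReg 0, copy innerReg baseReg, addMul stepReg blockLenReg innerReg,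
  const tableReg 0, copy innerReg baseReg, addMul tableReg stepReg innerReg,
  copy tableLenReg tableReg]

theorem wp_computeSizes (h : Prepared M S w tips σ) (hL : σ.reg blockLenReg = L) :
    wp computeSizes σ fun τ t => t ≤ 6 * (2 * N + 2) + 7 ∧
      τ.reg stepReg = ((2 * N + 2) * L : ℕ) ∧
      τ.reg tableReg = ((2 * N + 2) * (2 * N + 2) * L : ℕ) ∧
      τ.reg tableLenReg = ((2 * N + 2) * (2 * N + 2) * L : ℕ) := by
  simp only [computeSizes, wp_block_cons, wp_block_singleton, wp_add, wp_const]
  refine wp_addMul (2 * N + 2) (by simp [h.base, h.zero]) (by simp [h.one])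
    fun ρ₁ t₁ hF₁ hstep ht₁ => ?_
  have h₁ := ((h.setReg stepReg _).setReg innerReg _).frame hF₁
  replace hstep : ρ₁.reg stepReg = ((2 * N + 2) * L : ℕ) := by simp [hstep, hL]
  refine wp_addMul (2 * N + 2) (by simp [h₁.base, h₁.zero]) (by simp [h₁.one])
    fun ρ₂ t₂ hF₂ htable ht₂ => ?_
  have hzero₂ : ρ₂.reg zeroReg = 0 := (hF₂.reg _ (by decide)).trans h₁.zero
  have hstep₂ : ρ₂.reg stepReg = ((2 * N + 2) * L : ℕ) := (hF₂.reg _ (by decide)).trans hstep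
  replace htable : ρ₂.reg tableReg = ((2 * N + 2) * (2 * N + 2) * L : ℕ) := by
    simp [htable, hstep, mul_assoc]
  exact ⟨by omega, by simpa using hstep₂, by simpa using htable, by simpa [hzero₂] using htable⟩

/-- Extend the table of next codes by the tip in turn. -/
def processTip : RAMProg := block [
  computeLabel, computeSizes, extendTable, copy blockLenReg tableLenReg]

theorem time_processTip_le {N L W t : ℕ} (hW : (2 * N + 2) * (2 * N + 2) * L ≤ W)
    (ht : t ≤ N * (9 + 2) + 7 + (6 * (2 * N + 2) + 7) +
      ((2 * N + 2) * ((2 * N + 2) * (6 * (2 * N + 2) + 6 * L + 23 + 2) + 2 + 2) + 2) + 1) :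
    t ≤ 6 * W + 80 * (2 * N + 2) ^ 3 := by
  nlinarith [sq_nonneg N, pow_nonneg N.zero_le 3]

theorem wp_processTip (h : AtVertex M S w tips v σ) {j W : ℕ} (hj : j < tips.length)
    (htip : σ.reg tipIdxReg = j) (hL : σ.reg blockLenReg = L)
    (hW : (2 * N + 2) * (2 * N + 2) * L ≤ W) {old : ℕ → ℕ}
    (hold : ∀ k < L, σ.arr nextArr k = old k) :
    wp processTip σ fun τ t => t ≤ 6 * W + 80 * (2 * N + 2) ^ 3 ∧
      τ.reg blockLenReg = ((2 * N + 2) * (2 * N + 2) * L : ℕ) ∧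
      ∀ k < (2 * N + 2) * (2 * N + 2) * L, τ.arr nextArr k =
        (digit M S tips v tips[j] L (decodePair (2 * N + 2) (k / L)) + old (k % L) : ℕ) := by
  simp only [processTip, wp_block_cons, wp_block_singleton]
  refine wp_mono (wp_computeLabel h hj htip) fun ρ₁ t₁ hF₁ ⟨_, hlabel⟩ => ?_
  have h₁ := h.frame hF₁
  have hL₁ : ρ₁.reg blockLenReg = L := (hF₁.reg _ (by decide)).trans hL
  refine wp_mono (wp_computeSizes h₁.toPrepared hL₁)
    fun ρ₂ t₂ hF₂ ⟨_, hstep, htable, hlen⟩ => ?_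
  have h₂ : AtTip M S w tips v tips[j] L ρ₂ :=
    ⟨h₁.frame hF₂, (hF₂.reg _ (by decide)).trans hlabel, (hF₂.reg _ (by decide)).trans hL₁, hstep⟩
  have harr₂ : ρ₂.arr nextArr = σ.arr nextArr :=
    (hF₂.arr _ (by decide)).trans (hF₁.arr _ (by decide))
  refine wp_mono (wp_extendTable h₂ htable (harr₂ ▸ hold)) fun ρ₃ t₃ hF₃ ⟨_, hnew⟩ => ?_
  rw [wp_add]
  refine ⟨time_processTip_le hW (by omega), ?_, hnew⟩
  simp [hF₃.reg tableLenReg (by decide), hlen, (h₂.frame hF₃).zero]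

/-- Compute the table of next codes for the vertex in turn. -/
def computeNext : RAMProg := block [
  store nextArr zeroReg zeroReg, const blockLenReg 1, copy tipIdxReg tipsReg,
  forDown tipIdxReg processTip]

theorem wp_computeNext (h : AtVertex M S w tips v σ) :
    wp computeNext σ fun τ t =>
      t ≤ tips.length *
        (6 * numCodes (2 * N + 2) tips.length + 80 * (2 * N + 2) ^ 3 + 2) + 4 ∧
      ∀ k < numCodes (2 * N + 2) tips.length, τ.arr nextArr k = M.next S tips v k := by
  simp only [computeNext, wp_block_cons, wp_block_singleton, wp_add, wp_store, wp_const]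
  set W := numCodes (2 * N + 2) tips.length
  refine wp_forDown tips.length (6 * W + 80 * (2 * N + 2) ^ 3)
    (fun j ρ => ρ.reg blockLenReg = numCodes (2 * N + 2) (tips.drop j).length ∧
      ∀ k < numCodes (2 * N + 2) (tips.drop j).length, ρ.arr nextArr k =
        nextCode (2 * N + 2) W (2 * M.level v + 1) (if v ∈ S then 1 else 0) (M.label S v)
          (tips.drop j) k)
    (by simp [h.length, h.zero]) (by simp [h.one]) (by simp [numCodes, nextCode, h.zero]) ?_ ?_
  · rintro j hj ρ hF ⟨hlen, harr⟩
    have hρ : AtVertex M S w tips v ρ :=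
      (h.congr (fun r hr _ => by
        simp only [RAMState.setReg_reg, RAMState.setArr_reg, if_neg (show r ≠ 28 by omega),
          if_neg (show r ≠ 24 by omega)]) fun a ha _ => by
        funext i
        simp [(show a ≠ 11 by omega)]).frame hF
    have hsucc : numCodes (2 * N + 2) (tips.drop j).length =
        (2 * N + 2) * (2 * N + 2) * numCodes (2 * N + 2) (tips.drop (j + 1)).length := by
      rw [List.drop_eq_getElem_cons hj, List.length_cons, numCodes_succ]
    have hle : numCodes (2 * N + 2) (tips.drop j).length ≤ W :=
      Nat.pow_le_pow_right (by positivity) (by simp)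
    let old := nextCode (2 * N + 2) W (2 * M.level v + 1) (if v ∈ S then 1 else 0) (M.label S v)
      (tips.drop (j + 1))
    refine wp_mono (wp_processTip (hρ.setReg tipIdxReg j) hj (by simp) (by simpa using hlen)
      (hsucc ▸ hle) (old := old) (by simpa using harr)) fun τ t _ ⟨ht, hblock, hnew⟩ => ⟨ht, ?_, ?_⟩
    · rw [hblock, hsucc]
    · rw [hsucc]
      intro k hk
      rw [hnew k hk, List.drop_eq_getElem_cons hj, nextCode, digit]
  · rintro τ t - ⟨-, harr⟩ ht
    exact ⟨by omega, harr⟩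

end LeafageSFVS

/-! ### The layers of the dynamic program -/

namespace LeafageSFVS

open RAMProg

abbrev nextOffsetReg : ℕ := 38
abbrev codeReg : ℕ := 39
abbrev slotReg : ℕ := 40
abbrev nextReg : ℕ := 41
abbrev valueReg : ℕ := 42
abbrev takenReg : ℕ := 43
abbrev succReg : ℕ := 44
abbrev rejectReg : ℕ := 45

section Layers

variable {n : ℕ} (W : ℕ) (next : Fin n → ℕ → ℕ) (w : Fin n → ℤ)

/-- The code after the decision on the vertex `v`, which is followed by the list `l`. -/
def succCode (v : Fin n) (l : List (Fin n)) (k : ℕ) : ℕ :=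
  if Takes W next w v l k then next v k else k

/-- The best value and the decision for the code `k` and the vertex `v`, which is followed by the
list `l`, are stored. -/
structure StoresDecision (v : Fin n) (l : List (Fin n)) (k : ℕ) (σ : RAMState) : Prop where
  value : σ.arr valueArr ((l.length + 1) * W + k) = bestValue W next w (v :: l) k
  succ : σ.arr succArr ((l.length + 1) * W + k) = succCode W next w v l k
  reject : σ.arr rejectArr ((l.length + 1) * W + k) = if Takes W next w v l k then 0 else 1

/-- The best values and the decisions for the list `l` of vertices are stored. There is a layer of
`W` cells for each tail of `l`, and the layers are ordered by the lengths of the tails. -/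
def StoresLayers : List (Fin n) → RAMState → Prop
  | [], σ => ∀ k < W, σ.arr valueArr k = 0
  | v :: l, σ => σ.arr vertexArr l.length = (v : ℕ) ∧
      (∀ k < W, StoresDecision W next w v l k σ) ∧ StoresLayers l σ

/-- The vertices in the list `l` have been processed. -/
structure LayerInv (l : List (Fin n)) (σ : RAMState) : Prop where
  layers : σ.reg layersReg = l.length
  offset : σ.reg offsetReg = (l.length * W : ℕ)
  stores : StoresLayers W next w l σ

/-- Everything that the decisions on the vertex `v` depend on is available. -/
structure CanDecide (v : Fin n) (l : List (Fin n)) (σ : RAMState) : Prop where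
  one : σ.reg oneReg = 1
  zero : σ.reg zeroReg = 0
  codes : σ.reg codesReg = W
  offset : σ.reg offsetReg = (l.length * W : ℕ)
  nextOffset : σ.reg nextOffsetReg = ((l.length + 1) * W : ℕ)
  weight : σ.reg weightReg = w v
  best : ∀ k < W, σ.arr valueArr (l.length * W + k) = bestValue W next w l k
  next : ∀ k < W, σ.arr nextArr k = next v k

variable {W next w} {l : List (Fin n)} {v : Fin n} {k : ℕ} {σ τ : RAMState}

theorem StoresLayers.best (h : StoresLayers W next w l σ) (hk : k < W) :
    σ.arr valueArr (l.length * W + k) = bestValue W next w l k := by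
  cases l with
  | nil => simpa [bestValue] using h k hk
  | cons v l => exact (h.2.1 k hk).value

theorem StoresDecision.congr (h : StoresDecision W next w v l k σ)
    (ha : ∀ a < 15, 12 ≤ a →
      τ.arr a ((l.length + 1) * W + k) = σ.arr a ((l.length + 1) * W + k)) :
    StoresDecision W next w v l k τ where
  value := (ha _ (by decide) (by decide)).trans h.value
  succ := (ha _ (by decide) (by decide)).trans h.succ
  reject := (ha _ (by decide) (by decide)).trans h.reject

theorem StoresLayers.congr (h : StoresLayers W next w l σ)
    (ha : ∀ a < 15, 12 ≤ a → ∀ i < (l.length + 1) * W, τ.arr a i = σ.arr a i)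
    (hv : ∀ i < l.length, τ.arr vertexArr i = σ.arr vertexArr i) : StoresLayers W next w l τ := by
  induction l with
  | nil => exact fun k hk => (ha _ (by decide) (by decide) k (by simpa using hk)).trans (h k hk)
  | cons v l ih =>
    obtain ⟨hvertex, hdecision, hl⟩ := h
    rw [List.length_cons, Nat.succ_mul] at ha
    exact ⟨(hv _ (by simp)).trans hvertex,
      fun k hk => (hdecision k hk).congr fun a h₁ h₂ => ha a h₁ h₂ _ (by omega),
      ih hl (fun a h₁ h₂ i hi => ha a h₁ h₂ i (by omega)) fun i hi => hv i (by simp; omega)⟩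

namespace LayerInv

theorem congr (h : LayerInv W next w l σ) (hlayers : τ.reg layersReg = σ.reg layersReg)
    (hoffset : τ.reg offsetReg = σ.reg offsetReg)
    (ha : ∀ a < 16, 12 ≤ a → τ.arr a = σ.arr a) : LayerInv W next w l τ where
  layers := hlayers.trans h.layers
  offset := hoffset.trans h.offset
  stores := h.stores.congr (fun a h₁ h₂ _ _ => by rw [ha a (by omega) h₂])
    fun _ _ => by rw [ha _ (by decide) (by decide)]

theorem setReg (h : LayerInv W next w l σ) (d : ℕ) (z : ℤ) (hd : d ≠ 9 ∧ d ≠ 10 := by decide) :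
    LayerInv W next w l (σ.setReg d z) :=
  h.congr (by simp [hd.1.symm]) (by simp [hd.2.symm]) fun _ _ _ => rfl

theorem frame {p : RAMProg} (h : LayerInv W next w l σ) (hF : Frame p σ τ)
    (hlayers : layersReg ∉ p.regs := by decide) (hoffset : offsetReg ∉ p.regs := by decide)
    (ha : ∀ a < 16, 12 ≤ a → a ∉ p.arrs := by decide) : LayerInv W next w l τ :=
  h.congr (hF.reg _ hlayers) (hF.reg _ hoffset) fun a h₁ h₂ => hF.arr a (ha a h₁ h₂)

end LayerInv

/-- Make the decision for the code in turn. -/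
def decideCode : RAMProg := block [
  add addrReg offsetReg codeReg, load valueReg valueArr addrReg, copy succReg codeReg,
  const rejectReg 1,
  load nextReg nextArr codeReg, sub flagReg codesReg nextReg,
  .cond flagReg (block [
    add addrReg offsetReg nextReg, load takenReg valueArr addrReg, add takenReg takenReg weightReg,
    sub flagReg takenReg valueReg,
    .cond flagReg (block [
      copy valueReg takenReg, copy succReg nextReg, const rejectReg 0]) skip]) skip]

theorem wp_decideCode (h : CanDecide W next w v l σ) (hk : k < W) (hcode : σ.reg codeReg = k) :
    wp decideCode σ fun τ t => t ≤ 15 ∧ τ.reg valueReg = bestValue W next w (v :: l) k ∧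
      τ.reg succReg = succCode W next w v l k ∧
      τ.reg rejectReg = if Takes W next w v l k then 0 else 1 := by
  have haddr : ∀ i : ℕ, ((l.length : ℤ) * W + i).toNat = l.length * W + i := fun i => by
    rw [← Nat.cast_mul, ← Nat.cast_add, Int.toNat_natCast]
  rw [bestValue_cons, succCode]
  by_cases hlt : next v k < W
  · obtain hgt | hle := lt_or_ge (bestValue W next w l k) (w v + bestValue W next w l (next v k))
    · simp [decideCode, h.zero, h.codes, h.offset, h.weight, hcode, haddr, h.best _ hk,
        h.next _ hk, h.best _ hlt, hlt, add_comm _ (w v), Takes, hgt]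
    · simp [decideCode, h.zero, h.codes, h.offset, h.weight, hcode, haddr, h.best _ hk,
        h.next _ hk, h.best _ hlt, hlt, add_comm _ (w v), Takes, hle, hle.not_gt]
  · simp [decideCode, h.zero, h.codes, h.offset, hcode, haddr, h.best _ hk, h.next _ hk, hlt, Takes]

/-- Make and store the decision for the code in turn. -/
def updateCode : RAMProg := block [
  decideCode, add slotReg nextOffsetReg codeReg,
  store valueArr slotReg valueReg, store succArr slotReg succReg,
  store rejectArr slotReg rejectReg]

theorem wp_updateCode (h : CanDecide W next w v l σ) (hk : k < W) (hcode : σ.reg codeReg = k) :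
    wp updateCode σ fun τ t => t ≤ 19 ∧ StoresDecision W next w v l k τ ∧
      ∀ a, ∀ i ≠ (l.length + 1) * W + k, τ.arr a i = σ.arr a i := by
  have haddr : (((l.length : ℤ) + 1) * W + k).toNat = (l.length + 1) * W + k := by
    rw [← Nat.cast_succ, ← Nat.cast_mul, ← Nat.cast_add, Int.toNat_natCast]
  simp only [updateCode, wp_block_cons, wp_block_singleton]
  refine wp_mono (wp_decideCode h hk hcode) fun τ t hF ⟨_, hvalue, hsucc, hreject⟩ => ?_
  have hcodeτ := (hF.reg codeReg (by decide)).trans hcode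
  have hoffset := (hF.reg nextOffsetReg (by decide)).trans h.nextOffset
  have harr : τ.arr = σ.arr := funext fun a => hF.arr a List.not_mem_nil
  simp only [wp_add, wp_store]
  refine ⟨by omega, ⟨?_, ?_, ?_⟩, fun a i hi => ?_⟩
  · simp [hcodeτ, hoffset, haddr, hvalue]
  · simp [hcodeτ, hoffset, haddr, hsucc]
  · simp [hcodeτ, hoffset, haddr, hreject]
  · simp [hcodeτ, hoffset, haddr, hi, harr]

/-- Add the layer for the vertex in turn. -/
def addLayer : RAMProg := block [
  add nextOffsetReg offsetReg codesReg, copy codeReg codesReg, forDown codeReg updateCode,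
  copy offsetReg nextOffsetReg, store vertexArr layersReg vertexReg,
  add layersReg layersReg oneReg]

theorem wp_addLayer (h : LayerInv W next w l σ) (hone : σ.reg oneReg = 1)
    (hzero : σ.reg zeroReg = 0) (hW : σ.reg codesReg = W) (hv : σ.reg vertexReg = (v : ℕ))
    (hw : σ.reg weightReg = w v) (hnext : ∀ k < W, σ.arr nextArr k = next v k) :
    wp addLayer σ fun τ t => t ≤ W * (19 + 2) + 6 ∧ LayerInv W next w (v :: l) τ := by
  have hlen : (l.length + 1) * W = l.length * W + W := Nat.succ_mul _ _
  simp only [addLayer, wp_block_cons, wp_block_singleton, wp_add, wp_store]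
  refine wp_forDown W 19
    (fun i ρ => (∀ a, ∀ k < (l.length + 1) * W, ρ.arr a k = σ.arr a k) ∧
      ∀ k < W, i ≤ k → StoresDecision W next w v l k ρ)
    (by simp [hW, hzero]) (by simp [hone])
    ⟨fun _ _ _ => rfl, fun k hk hk' => absurd hk (not_lt.2 hk')⟩ ?_ ?_
  · rintro i hi ρ hF ⟨hold, hnew⟩
    have hρ : CanDecide W next w v l (ρ.setReg codeReg i) :=
      ⟨by simp [hF.reg oneReg (by decide), hone], by simp [hF.reg zeroReg (by decide), hzero],
        by simp [hF.reg codesReg (by decide), hW], by simp [hF.reg offsetReg (by decide), h.offset],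
        by simp [hF.reg nextOffsetReg (by decide), h.offset, hW, hlen],
        by simp [hF.reg weightReg (by decide), hw],
        fun k hk => (hold _ _ (by omega)).trans (h.stores.best hk),
        fun k hk => by simp [hF.arr nextArr (by decide), hnext k hk]⟩
    refine wp_mono (wp_updateCode hρ hi (by simp)) fun τ t _ ⟨ht, hdecision, hother⟩ =>
      ⟨ht, fun a k hk => (hother a k (by omega)).trans (hold a k hk), fun k hk hik => ?_⟩
    obtain rfl | hik := hik.eq_or_lt
    · exact hdecision
    · exact (hnew k hk hik).congr fun a _ _ => hother a _ (by omega)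
  · rintro τ t hF ⟨hold, hnew⟩ ht
    have hlayers : τ.reg layersReg = l.length := by simp [hF.reg layersReg (by decide), h.layers]
    refine ⟨by omega, ?_, ?_, ?_, fun k hk => ?_, ?_⟩
    · simp [hlayers, hF.reg oneReg (by decide), hone]
    · simp [hF.reg nextOffsetReg (by decide), hF.reg zeroReg (by decide), h.offset, hW, hzero, hlen]
    · simp [hlayers, hF.reg vertexReg (by decide), hv]
    · exact (hnew k hk k.zero_le).congr fun a _ _ => by simp [show a ≠ 15 by omega]
    · refine h.stores.congr (fun a _ _ i hi => ?_) fun i hi => ?_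
      · simpa [show a ≠ 15 by omega] using hold a i hi
      · simp [hlayers, hi.ne, hF.arr vertexArr (by decide)]

end Layers

variable {n : ℕ} {G : SimpleGraph (Fin n)} {N : ℕ} {M : TreeModel G N} {S : Finset (Fin n)}
  {w : Fin n → ℤ} {tips : List (Fin N)} {l : List (Fin n)} {v : Fin n} {i : ℕ} {σ : RAMState}

/-- Treat the vertex in `vertexReg`, whose level is in `sweepReg`. -/
def processVertex : RAMProg := block [
  load terminalReg terminalArr vertexReg, load weightReg weightArr vertexReg,
  add thresholdReg sweepReg sweepReg, add thresholdReg thresholdReg oneReg,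
  computeNext, addLayer]

/-- A bound on the time for processing a vertex, for `N` host nodes and `r` tips. -/
def vertexTime (N r : ℕ) : ℕ :=
  r * (6 * numCodes (2 * N + 2) r + 80 * (2 * N + 2) ^ 3 + 2) + 21 * numCodes (2 * N + 2) r + 14

theorem wp_processVertex (h : Prepared M S w tips σ)
    (hl : LayerInv (numCodes (2 * N + 2) tips.length) (M.next S tips) w l σ)
    (hv : σ.reg vertexReg = (v : ℕ)) (hrow : σ.reg rowReg = (N * v : ℕ))
    (hlevel : σ.reg sweepReg = M.level v) :
    wp processVertex σ fun τ t => t ≤ vertexTime N tips.length ∧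
      LayerInv (numCodes (2 * N + 2) tips.length) (M.next S tips) w (v :: l) τ := by
  simp only [processVertex, wp_block_cons, wp_block_singleton, wp_load, wp_add]
  refine wp_mono (wp_computeNext (v := v)
    ⟨(((h.setReg terminalReg _).setReg weightReg _).setReg thresholdReg _).setReg thresholdReg _,
      by simp [hrow], by simp [hv, h.terminal], by simp [hlevel, h.one, two_mul]⟩)
    fun ρ t hF ⟨_, hnext⟩ => ?_
  have hρ := ((((h.setReg terminalReg _).setReg weightReg _).setReg thresholdReg _).setReg
    thresholdReg _).frame hF
  have hlρ := ((((hl.setReg terminalReg _).setReg weightReg _).setReg thresholdReg _).setReg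
    thresholdReg _).frame hF
  refine wp_mono (wp_addLayer (v := v) hlρ hρ.one hρ.zero hρ.codes
    (by simp [hF.reg vertexReg (by decide), hv])
    (by simp [hF.reg weightReg (by decide), hv, h.weight]) hnext)
    fun τ t' _ ⟨_, hτ⟩ => ⟨by rw [vertexTime]; omega, hτ⟩

/-- The list `l` consists of the vertices with a larger value of `f` than `i`, and of those with the
value `i` from the vertex `j` on, in the order of the values. -/
structure IsSweep (f : Fin n → ℕ) (i j : ℕ) (l : List (Fin n)) : Prop where
  nodup : l.Nodup
  sorted : l.Pairwise fun a b => f a ≤ f b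
  mem_iff : ∀ u, u ∈ l ↔ i < f u ∨ f u = i ∧ j ≤ u

namespace IsSweep

variable {f : Fin n → ℕ}

theorem nil {m : ℕ} (hf : ∀ u, f u < m) : IsSweep f m 0 [] :=
  ⟨List.nodup_nil, List.Pairwise.nil, fun u => by have := hf u; simp; omega⟩

theorem lower (h : IsSweep f (i + 1) 0 l) : IsSweep f i n l :=
  ⟨h.nodup, h.sorted, fun u => by rw [h.mem_iff]; have := u.2; omega⟩

theorem skip (h : IsSweep f i (v + 1) l) (hv : f v ≠ i) : IsSweep f i v l := by
  refine ⟨h.nodup, h.sorted, fun u => ?_⟩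
  rw [h.mem_iff]
  obtain rfl | hne := eq_or_ne u v
  · omega
  · have := Fin.val_ne_of_ne hne
    omega

theorem cons (h : IsSweep f i (v + 1) l) (hv : f v = i) : IsSweep f i v (v :: l) := by
  refine ⟨List.nodup_cons.2 ⟨fun hmem => ?_, h.nodup⟩,
    List.pairwise_cons.2 ⟨fun u hu => ?_, h.sorted⟩, fun u => ?_⟩
  · have := (h.mem_iff v).1 hmem
    omega
  · have := (h.mem_iff u).1 hu
    omega
  · rw [List.mem_cons, h.mem_iff]
    obtain rfl | hne := eq_or_ne u v
    · simp [hv]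
    · have := Fin.val_ne_of_ne hne
      simp only [hne, false_or]
      omega

theorem mem (h : IsSweep f 0 0 l) (u : Fin n) : u ∈ l :=
  (h.mem_iff u).2 (by omega)

end IsSweep

/-- Treat the vertex in turn if its level is the one in turn. -/
def visitVertex : RAMProg := block [
  computeLevel, sub flagReg levelReg sweepReg,
  .cond flagReg skip (block [sub flagReg sweepReg levelReg, .cond flagReg skip processVertex])]

theorem wp_visitVertex (h : Prepared M S w tips σ) (hv : σ.reg vertexReg = (v : ℕ))
    (hi : σ.reg sweepReg = i) (hs : IsSweep M.level i (v + 1) l)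
    (hl : LayerInv (numCodes (2 * N + 2) tips.length) (M.next S tips) w l σ) :
    wp visitVertex σ fun τ t => ∃ l', IsSweep M.level i v l' ∧
      LayerInv (numCodes (2 * N + 2) tips.length) (M.next S tips) w l' τ ∧
      l.length * vertexTime N tips.length + t ≤
        l'.length * vertexTime N tips.length + (3 * n + 9 * N + 11) := by
  simp only [visitVertex, wp_block_cons, wp_block_singleton]
  refine wp_mono (wp_computeLevel h hv) fun ρ t hF ⟨_, hrow, hlevel⟩ => ?_
  have hiρ := (hF.reg sweepReg (by decide)).trans hi
  have hlρ := hl.frame hF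
  simp only [wp_sub, wp_cond, wp_skip, wp_block_cons, wp_block_singleton]
  obtain hgt | hle := lt_or_ge i (M.level v)
  · rw [if_pos (by simp [hlevel, hiρ, hgt])]
    exact ⟨l, hs.skip hgt.ne', hlρ.setReg flagReg _, by omega⟩
  rw [if_neg (by simp [hlevel, hiρ, hle])]
  obtain hlt | rfl := hle.lt_or_eq
  · rw [if_pos (by simp [hlevel, hiρ, hlt])]
    exact ⟨l, hs.skip hlt.ne, (hlρ.setReg flagReg _).setReg flagReg _, by omega⟩
  · rw [if_neg (by simp [hlevel, hiρ])]
    refine wp_mono (wp_processVertex (v := v) (((h.frame hF).setReg flagReg _).setReg flagReg _)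
      ((hlρ.setReg flagReg _).setReg flagReg _) (by simp [hF.reg vertexReg (by decide), hv])
      (by simp [hrow]) (by simp [hiρ])) fun τ t' _ ⟨_, hτ⟩ => ⟨v :: l, hs.cons rfl, hτ, ?_⟩
    rw [List.length_cons, Nat.succ_mul]
    omega

end LeafageSFVS

/-! ### The sweep over the levels -/

namespace LeafageSFVS

open RAMProg

section Sweep

variable {n : ℕ} {G : SimpleGraph (Fin n)} {N : ℕ} {M : TreeModel G N} {S : Finset (Fin n)}
  {w : Fin n → ℤ} {tips : List (Fin N)} {l : List (Fin n)} {i : ℕ} {σ : RAMState}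

/-- Treat the vertices of the level in `sweepReg`. -/
def sweepLevel : RAMProg := block [copy vertexReg orderReg, forDown vertexReg visitVertex]

theorem wp_sweepLevel (h : Prepared M S w tips σ) (hi : σ.reg sweepReg = i)
    (hs : IsSweep M.level (i + 1) 0 l)
    (hl : LayerInv (numCodes (2 * N + 2) tips.length) (M.next S tips) w l σ) :
    wp sweepLevel σ fun τ t => ∃ l', IsSweep M.level i 0 l' ∧
      LayerInv (numCodes (2 * N + 2) tips.length) (M.next S tips) w l' τ ∧
      l.length * vertexTime N tips.length + t ≤
        l'.length * vertexTime N tips.length + (n * (3 * n + 9 * N + 13) + 2) := by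
  simp only [sweepLevel, wp_block_cons, wp_block_singleton, wp_add]
  refine wp_forDown_elapsed n (fun j ρ s => ∃ l', IsSweep M.level i j l' ∧
      LayerInv (numCodes (2 * N + 2) tips.length) (M.next S tips) w l' ρ ∧
      l.length * vertexTime N tips.length + s ≤
        l'.length * vertexTime N tips.length + (n - j) * (3 * n + 9 * N + 13))
    (by simp [h.order, h.zero]) (by simp [h.one])
    ⟨l, hs.lower, hl.setReg vertexReg _, by omega⟩ ?_ ?_
  · rintro j hj ρ s hF ⟨l₁, hs₁, hl₁, _⟩
    have hρ := ((h.setReg vertexReg _).frame hF).setReg vertexReg j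
    refine wp_mono (wp_visitVertex (v := ⟨j, hj⟩) hρ (by simp)
      (by simp [hF.reg sweepReg (by decide), hi]) hs₁ (hl₁.setReg vertexReg _))
      fun τ t _ ⟨l₂, hs₂, hl₂, _⟩ => ⟨l₂, hs₂, hl₂, ?_⟩
    rw [show n - j = n - (j + 1) + 1 by omega, Nat.succ_mul]
    omega
  · rintro τ t _ ⟨l', hs', hl', _⟩
    exact ⟨l', hs', hl', by rw [Nat.sub_zero] at *; omega⟩

/-- Treat all the vertices, by decreasing levels. -/
def mainLoop : RAMProg := block [copy sweepReg nodesReg, forDown sweepReg sweepLevel]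

theorem wp_mainLoop (h : Prepared M S w tips σ)
    (hl : LayerInv (numCodes (2 * N + 2) tips.length) (M.next S tips) w [] σ) :
    wp mainLoop σ fun τ t => ∃ l, IsSweep M.level 0 0 l ∧
      LayerInv (numCodes (2 * N + 2) tips.length) (M.next S tips) w l τ ∧
      t ≤ l.length * vertexTime N tips.length + (N * (n * (3 * n + 9 * N + 13) + 4) + 2) := by
  simp only [mainLoop, wp_block_cons, wp_block_singleton, wp_add]
  refine wp_forDown_elapsed N (fun i ρ s => ∃ l, IsSweep M.level i 0 l ∧
      LayerInv (numCodes (2 * N + 2) tips.length) (M.next S tips) w l ρ ∧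
      s ≤ l.length * vertexTime N tips.length + (N - i) * (n * (3 * n + 9 * N + 13) + 4))
    (by simp [h.nodes, h.zero]) (by simp [h.one])
    ⟨[], .nil M.level_lt, hl.setReg sweepReg _, by omega⟩ ?_ ?_
  · rintro i hi ρ s hF ⟨l₁, hs₁, hl₁, _⟩
    have hρ := ((h.setReg sweepReg _).frame hF).setReg sweepReg i
    refine wp_mono (wp_sweepLevel hρ (by simp) hs₁ (hl₁.setReg sweepReg _))
      fun τ t _ ⟨l₂, hs₂, hl₂, _⟩ => ⟨l₂, hs₂, hl₂, ?_⟩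
    rw [show N - i = N - (i + 1) + 1 by omega, Nat.succ_mul]
    omega
  · rintro τ t _ ⟨l, hs, hl, _⟩
    exact ⟨l, hs, hl, by rw [Nat.sub_zero] at *; omega⟩

end Sweep

/-! ### The output -/

section Output

variable {n : ℕ} {W : ℕ} {next : Fin n → ℕ → ℕ} {w : Fin n → ℤ} {X : Finset (Fin n)}
  {l : List (Fin n)} {u v : Fin n} {k : ℕ} {σ : RAMState}

theorem length_eq_of_nodup_of_forall_mem (hnd : l.Nodup) (hmem : ∀ u, u ∈ l) : l.length = n :=
  Fin.equiv_iff_eq.1 ⟨hnd.getEquivOfForallMemList l hmem⟩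

theorem succCode_lt (hk : k < W) : succCode W next w v l k < W := by
  rw [succCode]
  split_ifs with ht
  exacts [ht.1, hk]

theorem chosenSet_cons (v : Fin n) (l : List (Fin n)) (k : ℕ) :
    chosenSet W next w (v :: l) k = if Takes W next w v l k
      then insert v (chosenSet W next w l (succCode W next w v l k))
      else chosenSet W next w l (succCode W next w v l k) := by
  rw [chosenSet, succCode]
  split_ifs <;> rfl

theorem mem_chosenSet_cons_self (hv : v ∉ l) :
    v ∈ chosenSet W next w (v :: l) k ↔ Takes W next w v l k := by
  have hnotMem : v ∉ chosenSet W next w l k := fun h =>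
    hv (List.mem_toFinset.1 (chosenSet_subset W next w _ _ h))
  rw [chosenSet]
  split_ifs with ht
  exacts [iff_of_true (Finset.mem_insert_self _ _) ht, iff_of_false hnotMem ht]

theorem mem_chosenSet_cons_of_ne (hu : u ≠ v) :
    u ∈ chosenSet W next w (v :: l) k ↔ u ∈ chosenSet W next w l (succCode W next w v l k) := by
  rw [chosenSet_cons]
  split_ifs
  exacts [Finset.mem_insert.trans (or_iff_right hu), Iff.rfl]

/-- The membership in `X` of the vertices outside the list `l` has been written to the output, and
that of the vertices in `l` is to be read off from the code `k`. -/
structure OutputInv (W : ℕ) (next : Fin n → ℕ → ℕ) (w : Fin n → ℤ) (X : Finset (Fin n))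
    (l : List (Fin n)) (k : ℕ) (σ : RAMState) : Prop where
  nodup : l.Nodup
  lt : k < W
  code : σ.reg codeReg = k
  offset : σ.reg offsetReg = (l.length * W : ℕ)
  stores : StoresLayers W next w l σ
  mem_iff : ∀ u ∈ l, u ∈ chosenSet W next w l k ↔ u ∉ X
  output : ∀ u ∉ l, σ.arr outputArr u = if u ∈ X then 1 else 0

/-- Write the decision on the last of the remaining vertices. -/
def writeDecision : RAMProg := block [
  load vertexReg vertexArr counterReg, add addrReg offsetReg codeReg,
  load rejectReg rejectArr addrReg, store outputArr vertexReg rejectReg,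
  load codeReg succArr addrReg, sub offsetReg offsetReg codesReg]

theorem wp_writeDecision (h : OutputInv W next w X (v :: l) k σ)
    (hcounter : σ.reg counterReg = l.length) (hW : σ.reg codesReg = W) :
    wp writeDecision σ fun τ t => t ≤ 6 ∧
      OutputInv W next w X l (succCode W next w v l k) τ := by
  obtain ⟨hvertex, hdecision, hstores⟩ := h.stores
  have hv := (List.nodup_cons.1 h.nodup).1
  have haddr : (((l.length : ℤ) + 1) * W + k).toNat = (l.length + 1) * W + k := by
    rw [← Nat.cast_succ, ← Nat.cast_mul, ← Nat.cast_add, Int.toNat_natCast]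
  have hreject : (if Takes W next w v l k then 0 else 1 : ℤ) = if v ∈ X then 1 else 0 := by
    have hmem := h.mem_iff v List.mem_cons_self
    rw [mem_chosenSet_cons_self hv] at hmem
    simp only [hmem, ite_not]
  simp only [writeDecision, wp_block_cons, wp_block_singleton, wp_load, wp_add, wp_store, wp_sub]
  refine ⟨by decide, (List.nodup_cons.1 h.nodup).2, succCode_lt h.lt, ?_, ?_, ?_, fun u hu => ?_,
    fun u hu => ?_⟩
  · simp [h.offset, h.code, haddr, (hdecision k h.lt).succ]
  · simp [h.offset, hW, add_mul]
  · exact hstores.congr (fun a _ _ i _ => by simp [show a ≠ 6 by omega]) fun i _ => by simp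
  · rw [← mem_chosenSet_cons_of_ne (ne_of_mem_of_not_mem hu hv),
      h.mem_iff u (List.mem_cons_of_mem _ hu)]
  · by_cases huv : u = v
    · simp [huv, hcounter, hvertex, h.offset, h.code, haddr, (hdecision k h.lt).reject, hreject]
    · simp [hcounter, hvertex, Fin.val_ne_of_ne huv, h.output u (by simp [huv, hu])]

/-- Write the set of the vertices that are not chosen, starting from the code `0`. -/
def writeOutput : RAMProg := block [
  const codeReg 0, copy counterReg orderReg, forDown counterReg writeDecision]

theorem wp_writeOutput (hW : 0 < W) (hone : σ.reg oneReg = 1) (hzero : σ.reg zeroReg = 0)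
    (horder : σ.reg orderReg = n) (hcodes : σ.reg codesReg = W) (hnd : l.Nodup)
    (hmem : ∀ u, u ∈ l) (h : LayerInv W next w l σ) :
    wp writeOutput σ fun τ t => t ≤ n * (6 + 2) + 3 ∧
      Outputs τ (chosenSet W next w l 0)ᶜ := by
  have hlen := length_eq_of_nodup_of_forall_mem hnd hmem
  simp only [writeOutput, wp_block_cons, wp_block_singleton, wp_const, wp_add]
  refine wp_forDown n 6 (fun i ρ => ∃ l' k, l'.length = i ∧
      OutputInv W next w (chosenSet W next w l 0)ᶜ l' k ρ)
    (by simp [horder, hzero]) (by simp [hone]) ?_ ?_ ?_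
  · exact ⟨l, 0, hlen, hnd, hW, by simp, by simp [h.offset],
      h.stores.congr (fun _ _ _ _ _ => rfl) fun _ _ => rfl, by simp, fun u hu => (hu (hmem u)).elim⟩
  · rintro i _ ρ hF ⟨l', k, hlen', hρ⟩
    obtain _ | ⟨v, l'⟩ := l'
    · cases hlen'
    have hcodesρ : ρ.reg codesReg = W := by simpa [hcodes] using hF.reg codesReg (by decide)
    refine wp_mono (wp_writeDecision (σ := ρ.setReg counterReg i) ⟨hρ.nodup, hρ.lt,
      by simp [hρ.code], by simp [hρ.offset], hρ.stores.congr (fun _ _ _ _ _ => rfl) fun _ _ => rfl,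
      hρ.mem_iff, hρ.output⟩ (by simpa using hlen'.symm) (by simpa using hcodesρ))
      fun τ t _ ⟨ht, hτ⟩ => ⟨ht, l', _, Nat.succ.inj hlen', hτ⟩
  · rintro τ t _ ⟨l', k, hlen', hτ⟩ _
    obtain rfl := List.eq_nil_of_length_eq_zero hlen'
    exact ⟨by omega, fun v => hτ.output v List.not_mem_nil⟩

end Output

end LeafageSFVS

/-! ### The program and its running time -/

namespace LeafageSFVS

open RAMProg

section Time

variable {n N b r ℓ : ℕ}

theorem numCodes_le {B : ℕ} (hB : B ≤ b) (hb : 0 < b) (hr : r ≤ ℓ) :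
    numCodes B r ≤ b ^ (2 * ℓ) := by
  rw [numCodes, ← pow_two, ← pow_mul]
  exact (Nat.pow_le_pow_left hB _).trans (Nat.pow_le_pow_right hb (by omega))

theorem vertexTime_le (hN : 2 * N + 2 ≤ b) (hr : r ≤ ℓ) (hℓ : 2 ≤ ℓ) :
    vertexTime N r ≤ 100 * (ℓ + 1) * b ^ (2 * ℓ) := by
  have hcodes := numCodes_le hN (by omega) hr
  have hcube : (2 * N + 2) ^ 3 ≤ b ^ (2 * ℓ) :=
    (Nat.pow_le_pow_left hN 3).trans (Nat.pow_le_pow_right (by omega) (by omega))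
  have hpos : 0 < b ^ (2 * ℓ) := Nat.pow_pos (by omega)
  calc vertexTime N r
      = r * (6 * numCodes (2 * N + 2) r + 80 * (2 * N + 2) ^ 3 + 2)
        + 21 * numCodes (2 * N + 2) r + 14 := rfl
    _ ≤ ℓ * (88 * b ^ (2 * ℓ)) + 21 * b ^ (2 * ℓ) + 14 * b ^ (2 * ℓ) := by
      gcongr <;> omega
    _ ≤ 100 * (ℓ + 1) * b ^ (2 * ℓ) := by nlinarith

theorem sweepTime_le (hn : n ≤ b) (hN : N ≤ b) (hb : 0 < b) :
    N * (n * (3 * n + 9 * N + 13) + 4) + 2 ≤ 31 * b ^ 3 :=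
  calc N * (n * (3 * n + 9 * N + 13) + 4) + 2
      ≤ b * (b * (3 * b + 9 * b + 13 * b) + 4 * (b * b)) + 2 * (b * b * b) := by
        have : 0 < b * b * b := by positivity
        have : 1 ≤ b * b := Nat.mul_pos hb hb
        gcongr <;> omega
    _ = 31 * b ^ 3 := by ring

theorem totalTime_le (hn : n ≤ b) (hN : 2 * N + 2 ≤ b) (hr : r ≤ ℓ) (hℓ : 2 ≤ ℓ) :
    100 * (r + 1) * (N + 1) ^ 2 +
      (n * vertexTime N r + (N * (n * (3 * n + 9 * N + 13) + 4) + 2)) + (n * (6 + 2) + 3) ≤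
      1000 * (ℓ + 1) * b ^ (2 * ℓ + 1) := by
  have hb : 0 < b := by omega
  have hpow : ∀ m ≤ 5, b ^ m ≤ b ^ (2 * ℓ + 1) := fun m hm => Nat.pow_le_pow_right hb (by omega)
  have hprepare : 100 * (r + 1) * (N + 1) ^ 2 ≤ 100 * (ℓ + 1) * b ^ (2 * ℓ + 1) :=
    calc 100 * (r + 1) * (N + 1) ^ 2 ≤ 100 * (ℓ + 1) * b ^ 2 := by gcongr; omega
      _ ≤ 100 * (ℓ + 1) * b ^ (2 * ℓ + 1) := Nat.mul_le_mul_left _ (hpow 2 (by decide))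
  have hvertices : n * vertexTime N r ≤ 100 * (ℓ + 1) * b ^ (2 * ℓ + 1) :=
    calc n * vertexTime N r ≤ b * (100 * (ℓ + 1) * b ^ (2 * ℓ)) :=
          Nat.mul_le_mul hn (vertexTime_le hN hr hℓ)
      _ = 100 * (ℓ + 1) * b ^ (2 * ℓ + 1) := by ring
  have hsweep := (sweepTime_le hn (by omega) hb).trans (Nat.mul_le_mul_left 31 (hpow 3 (by decide)))
  have hone := hpow 0 (by decide)
  have hlin := hpow 1 (by decide)
  rw [pow_one] at hlin
  nlinarith

end Time

section Program

variable {n : ℕ} {G : SimpleGraph (Fin n)} {N : ℕ}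

/-- The algorithm for Subset Feedback Vertex Set on a tree model. -/
def program : RAMProg := block [prepare, mainLoop, writeOutput]

theorem length_tips {T : HostTree N} {tips : List (Fin N)} (hnd : tips.Nodup)
    (hmem : ∀ p, p ∈ tips ↔ T.IsTip p) : tips.length = T.numRootedLeaves := by
  have htips : {p | T.IsLeafOf Set.univ p} = ↑tips.toFinset := by
    ext p
    simp [hmem, HostTree.isLeafOf_univ_iff]
  rw [HostTree.numRootedLeaves, htips, Set.ncard_coe_finset, List.toFinset_card_of_nodup hnd]

theorem wp_program (hN : 1 < N) {b ℓ : ℕ} (hn : n ≤ b) (hb : 2 * N + 2 ≤ b) (hℓ : 2 ≤ ℓ)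
    (M : TreeModel G N) (hleaves : M.host.numRootedLeaves ≤ ℓ) (S : Finset (Fin n))
    (w : Fin n → ℤ) :
    wp program (inputState G S w M) fun τ t => t ≤ 1000 * (ℓ + 1) * b ^ (2 * ℓ + 1) ∧
      ∃ X, Outputs τ X ∧ IsMinSubsetFVS G S w X := by
  simp only [program, wp_block_cons, wp_block_singleton]
  refine wp_mono (wp_prepare M S w) fun σ₁ t₁ _
    ⟨tips, hnd, hmem, h₁, hlayers, hoffset, hvalue, _⟩ => ?_
  have hl₁ : LayerInv (numCodes (2 * N + 2) tips.length) (M.next S tips) w [] σ₁ :=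
    ⟨hlayers, by simp [hoffset], fun k _ => hvalue k⟩
  refine wp_mono (wp_mainLoop h₁ hl₁) fun σ₂ t₂ hF₂ ⟨l, hs, hl, ht₂⟩ => ?_
  have h₂ := h₁.frame hF₂
  refine wp_mono (wp_writeOutput (by rw [numCodes]; positivity) h₂.one h₂.zero h₂.order h₂.codes
    hs.nodup hs.mem hl) fun τ t₃ _ ⟨_, hout⟩ => ⟨?_, _, hout, ?_⟩
  · have := totalTime_le hn hb ((length_tips hnd hmem).trans_le hleaves) hℓ
    rw [length_eq_of_nodup_of_forall_mem hs.nodup hs.mem] at ht₂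
    omega
  · exact M.isMinSubsetFVS_compl_chosenSet hN (fun p hp => (hmem p).2 hp) w hs.nodup hs.sorted
      hs.mem

end Program

end LeafageSFVS

theorem TreeModel.IsExpanded.one_lt {n N : ℕ} {G : SimpleGraph (Fin n)} {M : TreeModel G N}
    (hM : M.IsExpanded) (v : Fin n) : 1 < N := by
  obtain ⟨x, -, hroot, -⟩ := hM.1 v
  obtain ⟨t, ht, -⟩ := (M.isSubtree v).exists_isRootOf
  exact Fin.nontrivial_iff_two_le.1 ⟨x, t, fun h => hroot (h ▸ ht)⟩

theorem theorem1_general :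
    ∃ P : RAMProg, ∀ ℓ : ℕ, 2 ≤ ℓ → ∀ K : ℕ, ∃ C : ℕ,
      ∀ (n : ℕ) (G : SimpleGraph (Fin n)) (N : ℕ) (M : TreeModel G N), 1 < N →
      M.host.numRootedLeaves ≤ ℓ → N ≤ K * n →
      ∀ (S : Finset (Fin n)) (w : Fin n → ℤ),
      ∃ (τ : RAMState) (t : ℕ) (X : Finset (Fin n)),
        Exec P (inputState G S w M) τ t ∧ t ≤ C * n ^ (2 * ℓ + 1) ∧
        Outputs τ X ∧ IsMinSubsetFVS G S w X := by
  refine ⟨LeafageSFVS.program, fun ℓ hℓ K => ⟨1000 * (ℓ + 1) * (2 * K + 2) ^ (2 * ℓ + 1), ?_⟩⟩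
  intro n G N M hN hleaves hK S w
  have hn : 0 < n := Nat.pos_of_ne_zero (by rintro rfl; omega)
  obtain ⟨τ, t, hexec, ht, X, hout, hmin⟩ := LeafageSFVS.wp_program hN (b := (2 * K + 2) * n)
    (Nat.le_mul_of_pos_left n (by omega)) (by nlinarith) hℓ M hleaves S w
  exact ⟨τ, t, X, hexec, by rwa [mul_pow, ← mul_assoc] at ht, hout, hmin⟩

theorem theorem1 :
    ∃ P : RAMProg, ∀ ℓ : ℕ, 2 ≤ ℓ → ∀ K : ℕ, ∃ C : ℕ,
      ∀ (n : ℕ) (G : SimpleGraph (Fin n)), G.Connected → leafage G = ℓ →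
      ∀ (N : ℕ) (M : TreeModel G N), M.IsExpanded → M.host.numRootedLeaves ≤ ℓ → N ≤ K * n →
      ∀ (S : Finset (Fin n)) (w : Fin n → ℤ),
      ∃ (τ : RAMState) (t : ℕ) (X : Finset (Fin n)),
        Exec P (inputState G S w M) τ t ∧ t ≤ C * n ^ (2 * ℓ + 1) ∧
        Outputs τ X ∧ IsMinSubsetFVS G S w X := by
  obtain ⟨P, hP⟩ := theorem1_general
  refine ⟨P, fun ℓ hℓ K => ?_⟩
  obtain ⟨C, hC⟩ := hP ℓ hℓ K
  exact ⟨C, fun n G hG _ N M hM => hC n G N M (hM.one_lt hG.nonempty.some)⟩
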